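/- **Theorem.** Let $(\overline M,\overline g,J)$ be a locally metallic Riemannian manifold: a Riemannian manifold with a smooth $(1,1)$-tensor field $J$ such that $J^2=pJ+qI$ for some positive integers $p,q$, $\overline g(JU,V)=\overline g(U,JV)$ for all $U,V$, and $\overline\nabla J=0$, where $\overline\nabla$ is the Levi-Civita connection of $\overline g$. Let $(M_\theta,g_1)$ and $(M_T,g_2)$ be Riemannian manifolds, let $f:M_\theta\to(0,\infty)$ be smooth, and let $M=M_\theta\times_f M_T$ be their warped product, i.e. $M_\theta\times M_T$ with the metric $g=\pi_1^*g_1+(f\circ\pi_1)^2\,\pi_2^*g_2$. Suppose that $M$ is isometrically immersed in $\overline M$ as a warped product pointwise semi-slant submanifold: * $M_\theta$ is a pointwise slant submanifold with $\theta\in(0,\pi/2)$, i.e. on each leaf $M_\theta\times\{y\}$ the angle between $JX$ and the tangent space $T_xM_\theta$ is equal to $\theta_x$ for all nonzero $X\in T_xM_\theta$ (so the cosine of $\theta_x$ is the norm of the component of $JX$ tangent to $M_\theta$ divided by $\|JX\|$), where $\theta_x\in(0,\pi/2)$ may depend on the point; * $M_T$ is an invariant submanifold, i.e. on each leaf $\{x\}\times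 M_T$ we have $J(TM_T)\subseteq TM_T$. For vectors $X$ tangent to $M$ write $JX=TX+NX$ with $TX$ tangent and $NX$ normal to $M$, and let $T_1=P_1\circ T$, where $P_1$ is the projection of $TM=TM_\theta\oplus TM_T$ onto $TM_\theta$. Let $h$ be the second fundamental form of $M$ in $\overline M$ and let $A_V$ be the shape operator in the direction of a normal vector $V$, so $g(A_VX,Y)=\overline g(h(X,Y),V)$. Then for all smooth vector fields $X,Y$ on $M$ tangent to $M_\theta$ (in particular for the lifts of vector fields on $M_\theta$), the vector field $$A_{NT_1Y}X-A_{NT_1X}Y$$ is tangent to $M_\theta$ at every point of $M$. -/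

import Mathlib

open Bundle FiberBundle VectorField
open scoped Manifold ContDiff

set_option linter.unusedSectionVars false

noncomputable section

section Extend

variable {E : Type*} [NormedAddCommGroup E] [NormedSpace ℝ E]
  {H : Type*} [TopologicalSpace H] {I : ModelWithCorners ℝ E H}
  {M : Type*} [TopologicalSpace M] [ChartedSpace H M] [IsManifold I ∞ M]

theorem extend_eventually_linear {x : M} (a b : ℝ) (u v : TangentSpace I x) :
    ∀ᶠ y in nhds x, extend E (a • u + b • v) y = a • extend E u y + b • extend E v y := by
  have hb : ∀ᶠ y in nhds x, y ∈ (trivializationAt E (TangentSpace I : M → Type _) x).baseSet :=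
      ((trivializationAt E (TangentSpace I : M → Type _) x).open_baseSet.mem_nhds
        (mem_baseSet_trivializationAt' x))
  refine hb.mono fun y hy ↦ ?_
  simp only [extend]
  have hx : x ∈ (trivializationAt E (TangentSpace I : M → Type _) x).baseSet :=
    (mem_baseSet_trivializationAt' x)
  rw [← Trivialization.symmL_apply (R := ℝ) _ hy, ← Trivialization.symmL_apply (R := ℝ) _ hy,
    ← Trivialization.symmL_apply (R := ℝ) _ hy, ← map_smul, ← map_smul, ← map_add]
  congr 1
  have h := fun w : TangentSpace I x ↦
    congrFun (Trivialization.coe_linearMapAt_of_mem (R := ℝ)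
     (trivializationAt E (TangentSpace I : M → Type _) x) hx) w
  rw [← h, ← h, ← h, map_add, map_smul, map_smul]

end Extend

section LeviCivita

variable {E : Type*} [NormedAddCommGroup E] [NormedSpace ℝ E] [FiniteDimensional ℝ E]
  {H : Type*} [TopologicalSpace H] {I : ModelWithCorners ℝ E H}
  {M : Type*} [TopologicalSpace M] [ChartedSpace H M]

instance tangentSpace_finiteDimensional (x : M) : FiniteDimensional ℝ (TangentSpace I x) :=
  inferInstanceAs (FiniteDimensional ℝ E)

variable [RiemannianBundle (fun x : M ↦ TangentSpace I x)]

/-- The Koszul expression, equal to `2 ⟨∇_X Y, Z⟩` for the Levi-Civita connection `∇`: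
`X⟨Y,Z⟩ + Y⟨X,Z⟩ - Z⟨X,Y⟩ + ⟨[X,Y],Z⟩ - ⟨[X,Z],Y⟩ - ⟨[Y,Z],X⟩`. -/
def koszul (X Y Z : Π x : M, TangentSpace I x) (x : M) : ℝ :=
  mvfderiv I (fun y ↦ inner ℝ (Y y) (Z y)) x (X x)
    + mvfderiv I (fun y ↦ inner ℝ (X y) (Z y)) x (Y x)
    - mvfderiv I (fun y ↦ inner ℝ (X y) (Y y)) x (Z x)
    + inner ℝ (mlieBracket I X Y x) (Z x)
    - inner ℝ (mlieBracket I X Z x) (Y x)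
    - inner ℝ (mlieBracket I Y Z x) (X x)

variable [IsManifold I ∞ M] [IsContMDiffRiemannianBundle I ∞ E (fun x : M ↦ TangentSpace I x)]

theorem mdifferentiableAt_inner {x : M} {Y Z : Π x : M, TangentSpace I x}
    (hY : MDiffAt (T% Y) x) (hZ : MDiffAt (T% Z) x) :
    MDiffAt (fun y ↦ inner ℝ (Y y) (Z y)) x :=
  MDifferentiableAt.inner_bundle (F := E) (E := fun x : M ↦ TangentSpace I x)
    (b := fun x ↦ x) hY hZ

instance tangentSpace_completeSpace (x : M) : CompleteSpace (TangentSpace I x) :=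
  FiniteDimensional.complete ℝ _

theorem koszul_tensorial_left {x : M} {Y Z : Π x : M, TangentSpace I x}
    (hY : MDiffAt (T% Y) x) (hZ : MDiffAt (T% Z) x) :
    TensorialAt I E (fun X ↦ koszul X Y Z x) x where
  smul := by
    intro f X hf hX
    have : CompleteSpace E := FiniteDimensional.complete ℝ E
    simp [koszul, mlieBracket_smul_left hf hX, inner_add_left, inner_smul_left, inner_smul_right,
      mvfderiv_fun_mul hf (mdifferentiableAt_inner hX hZ), mvfderiv_fun_mul hf (mdifferentiableAt_inner hX hY)]
    ring
  add := by
    intro X X' hX hX'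
    have : CompleteSpace E := FiniteDimensional.complete ℝ E
    simp [koszul, mlieBracket_add_left hX hX', inner_add_left, inner_add_right,
      mvfderiv_fun_add (mdifferentiableAt_inner hX hZ) (mdifferentiableAt_inner hX' hZ),
      mvfderiv_fun_add (mdifferentiableAt_inner hX hY) (mdifferentiableAt_inner hX' hY)]
    ring

theorem koszul_tensorial_right {x : M} {X Y : Π x : M, TangentSpace I x}
    (hX : MDiffAt (T% X) x) (hY : MDiffAt (T% Y) x) :
    TensorialAt I E (fun Z ↦ koszul X Y Z x) x where
  smul := by
    intro f Z hf hZ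
    have : CompleteSpace E := FiniteDimensional.complete ℝ E
    simp [koszul, mlieBracket_smul_right hf hZ, inner_add_left, inner_smul_left, inner_smul_right,
      mvfderiv_fun_mul hf (mdifferentiableAt_inner hX hZ), mvfderiv_fun_mul hf (mdifferentiableAt_inner hY hZ)]
    rw [real_inner_comm (Z x) (Y x), real_inner_comm (Z x) (X x)]
    ring
  add := by
    intro Z Z' hZ hZ'
    have : CompleteSpace E := FiniteDimensional.complete ℝ E
    simp [koszul, mlieBracket_add_right hZ hZ', inner_add_left, inner_add_right,
      mvfderiv_fun_add (mdifferentiableAt_inner hX hZ) (mdifferentiableAt_inner hX hZ'),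
      mvfderiv_fun_add (mdifferentiableAt_inner hY hZ) (mdifferentiableAt_inner hY hZ')]
    ring

open Classical in
/-- For `Y` differentiable at `x`, the bilinear form `(X, Z) ↦ koszul X Y Z x` on `T_x M`. -/
def koszulForm (Y : Π x : M, TangentSpace I x) (x : M) :
    TangentSpace I x →L[ℝ] TangentSpace I x →L[ℝ] ℝ :=
  if h : MDiffAt (T% Y) x then
    TensorialAt.mkHom₂ (F := E) (F' := E) (I := I) (fun X Z ↦ koszul X Y Z x) x
      (fun _ hZ ↦ koszul_tensorial_left h hZ) (fun _ hX ↦ koszul_tensorial_right hX h)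
  else 0

theorem koszulForm_apply {X Y Z : Π x : M, TangentSpace I x} {x : M}
    (hX : MDiffAt (T% X) x) (hY : MDiffAt (T% Y) x) (hZ : MDiffAt (T% Z) x) :
    koszulForm Y x (X x) (Z x) = koszul X Y Z x := by
  rw [koszulForm, dif_pos hY]
  exact TensorialAt.mkHom₂_apply _ _ hX hZ

/-- `∇_u Y`: the vector `a` with `2 ⟨a, w⟩ = koszulForm Y x u w` for all `w`. -/
def leviCivitaFun (Y : Π x : M, TangentSpace I x) (x : M) :
    TangentSpace I x →L[ℝ] TangentSpace I x :=
  LinearMap.toContinuousLinearMap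
    { toFun := fun u ↦ (1 / 2 : ℝ) • (InnerProductSpace.toDual ℝ (TangentSpace I x)).symm
        (koszulForm Y x u)
      map_add' := by intro u v; simp
      map_smul' := by intro c u; simp [smul_comm c] }

theorem inner_leviCivitaFun (Y : Π x : M, TangentSpace I x) (x : M) (u w : TangentSpace I x) :
    inner ℝ (leviCivitaFun Y x u) w = 1 / 2 * koszulForm Y x u w := by
  simp [leviCivitaFun, inner_smul_left]

theorem inner_leviCivitaFun' {X Y Z : Π x : M, TangentSpace I x} {x : M}
    (hX : MDiffAt (T% X) x) (hY : MDiffAt (T% Y) x) (hZ : MDiffAt (T% Z) x) :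
    inner ℝ (leviCivitaFun Y x (X x)) (Z x) = 1 / 2 * koszul X Y Z x := by
  rw [inner_leviCivitaFun, koszulForm_apply hX hY hZ]

variable (I M) in
/-- The Levi-Civita connection of a Riemannian manifold; `leviCivita I M Y x u` is `∇_u Y`. -/
def leviCivita : CovariantDerivative I E (fun x : M ↦ TangentSpace I x) where
  toFun := leviCivitaFun
  isCovariantDerivativeOnUniv :=
    { add := by
        intro Y Y' x hY hY' _
        ext u
        refine ext_inner_right ℝ fun w ↦ ?_
        have hu := mdifferentiableAt_extend I E u
        have hw := mdifferentiableAt_extend I E w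
        have : CompleteSpace E := FiniteDimensional.complete ℝ E
        have h1 := inner_leviCivitaFun' hu (mdifferentiableAt_add_section hY hY') hw
        have h2 := inner_leviCivitaFun' hu hY hw
        have h3 := inner_leviCivitaFun' hu hY' hw
        simp only [extend_apply_self] at h1 h2 h3
        simp only [add_apply, inner_add_left, h1, h2, h3]
        simp [koszul, mlieBracket_add_left hY hY', mlieBracket_add_right hY hY',
          inner_add_left, inner_add_right,
          mvfderiv_fun_add (mdifferentiableAt_inner hY hw) (mdifferentiableAt_inner hY' hw),
          mvfderiv_fun_add (mdifferentiableAt_inner hu hY) (mdifferentiableAt_inner hu hY')]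
        ring
      leibniz := by
        intro Y f x hY hf _
        ext u
        refine ext_inner_right ℝ fun w ↦ ?_
        have hu := mdifferentiableAt_extend I E u
        have hw := mdifferentiableAt_extend I E w
        have : CompleteSpace E := FiniteDimensional.complete ℝ E
        have h1 := inner_leviCivitaFun' hu (hf.smul_section hY) hw
        have h2 := inner_leviCivitaFun' hu hY hw
        simp only [extend_apply_self] at h1 h2
        have h1' : inner ℝ (leviCivitaFun (f • Y) x u) w =
          1 / 2 * koszul (extend E u) (f • Y) (extend E w) x := h1
        simp only [add_apply, inner_add_left, h1', h2,
          smul_apply, inner_smul_left, ContinuousLinearMap.smulRight_apply]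
        simp [koszul, mlieBracket_smul_left hf hY, mlieBracket_smul_right hf hY,
          inner_add_left, inner_smul_left, inner_smul_right,
          mvfderiv_fun_mul hf (mdifferentiableAt_inner hY hw), mvfderiv_fun_mul hf (mdifferentiableAt_inner hu hY)]
        rw [real_inner_comm u (Y x)]
        ring }

theorem leviCivita_apply (Y : Π x : M, TangentSpace I x) :
   leviCivita I M Y = leviCivitaFun Y := rfl


/-- The Levi-Civita connection is torsion free. -/
theorem leviCivita_torsion : (leviCivita I M).torsion = 0 := by
  rw [CovariantDerivative.torsion_eq_zero_iff]
  intro X Y x hX hY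
  refine ext_inner_right ℝ fun w ↦ ?_
  have hw := mdifferentiableAt_extend I E w
  have h1 := inner_leviCivitaFun' hX hY hw
  have h2 := inner_leviCivitaFun' hY hX hw
  simp only [extend_apply_self] at h1 h2
  rw [leviCivita_apply, leviCivita_apply, inner_sub_left, h1, h2]
  have hs : mlieBracket I Y X x = - mlieBracket I X Y x := mlieBracket_swap_apply
  have hc : (fun y ↦ inner ℝ (X y) (Y y)) = fun y ↦ inner ℝ (Y y) (X y) :=
    funext fun y ↦ real_inner_comm _ _
  simp only [koszul, extend_apply_self, hs, hc, inner_neg_left]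
  ring

/-- The Levi-Civita connection is compatible with the metric. -/
theorem leviCivita_inner {X Y Z : Π x : M, TangentSpace I x} {x : M}
    (hX : MDiffAt (T% X) x) (hY : MDiffAt (T% Y) x) (hZ : MDiffAt (T% Z) x) :
    mvfderiv I (fun y ↦ inner ℝ (Y y) (Z y)) x (X x) =
      inner ℝ (leviCivita I M Y x (X x)) (Z x) + inner ℝ (Y x) (leviCivita I M Z x (X x)) := by
  rw [real_inner_comm _ (Y x), leviCivita_apply, leviCivita_apply, inner_leviCivitaFun' hX hY hZ,
    inner_leviCivitaFun' hX hZ hY]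
  have hs : mlieBracket I Z Y x = - mlieBracket I Y Z x := mlieBracket_swap_apply
  have hc : (fun y ↦ inner ℝ (Z y) (Y y)) = fun y ↦ inner ℝ (Y y) (Z y) :=
    funext fun y ↦ real_inner_comm _ _
  simp only [koszul, hs, hc, inner_neg_left]
  ring

end LeviCivita

section Submanifold

variable {E : Type*} [NormedAddCommGroup E] [NormedSpace ℝ E] [FiniteDimensional ℝ E]
  {H : Type*} [TopologicalSpace H] {I : ModelWithCorners ℝ E H}
  {M : Type*} [TopologicalSpace M] [ChartedSpace H M] [IsManifold I ∞ M]
  [RiemannianBundle (fun x : M ↦ TangentSpace I x)]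
  [IsContMDiffRiemannianBundle I ∞ E (fun x : M ↦ TangentSpace I x)]
  {E' : Type*} [NormedAddCommGroup E'] [NormedSpace ℝ E'] [FiniteDimensional ℝ E']
  {H' : Type*} [TopologicalSpace H'] {I' : ModelWithCorners ℝ E' H'}
  {N : Type*} [TopologicalSpace N] [ChartedSpace H' N] [IsManifold I' ∞ N]

variable (I I') in
/-- The image `F_* (T_x N)` in the tangent space of `M` at `F x`. -/
def tangentRange (F : N → M) (x : N) : Submodule ℝ (TangentSpace I (F x)) :=
  LinearMap.range (mfderiv I' I F x).toLinearMap

variable (I I') in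
/-- The covariant derivative `u ↦ ∇_{F_* u} s` of a vector field `s` along `F : N → M` (the
pullback of the Levi-Civita connection of `M` by `F`): if `(e_a)` is the frame of constant sections
in the preferred trivialization of `TM` at `F x` and `s = ∑ a, s^a e_a ∘ F` near `x`, this is
`∑ a, ds^a(u) e_a + s^a(x) ∇_{F_* u} e_a`. -/
def derivAlong (F : N → M) (s : Π y : N, TangentSpace I (F y)) (x : N) :
    TangentSpace I' x →L[ℝ] TangentSpace I (F x) :=
  let e := trivializationAt E (TangentSpace I : M → Type _) (F x)
  (e.symmL ℝ (F x)).comp (mvfderiv I' (fun y ↦ e.continuousLinearMapAt ℝ (F y) (s y)) x)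
    + (leviCivita I M (extend E (s x)) (F x)).comp (mfderiv I' I F x)

theorem leviCivita_eq_derivAlong_id {x : M} {Y : Π y : M, TangentSpace I y}
    (hY : MDiffAt (T% Y) x) :
    leviCivita I M Y x =
      ((trivializationAt E (TangentSpace I : M → Type _) x).symmL ℝ x).comp (mvfderiv I (fun y ↦
        (trivializationAt E (TangentSpace I : M → Type _) x).continuousLinearMapAt ℝ y (Y y)) x)
      + leviCivita I M (extend E (Y x)) x := by
  set e := trivializationAt E (TangentSpace I : M → Type _) x with he
  have hx : x ∈ e.baseSet := mem_baseSet_trivializationAt' x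
  have hb : ∀ᶠ y in nhds x, y ∈ e.baseSet := e.open_baseSet.mem_nhds hx
  have hcoord {Z : Π y : M, TangentSpace I y} (hZ : MDiffAt (T% Z) x) :
      MDifferentiableAt I 𝓘(ℝ, E) (fun y ↦ e.continuousLinearMapAt ℝ y (Z y)) x := by
    refine ((mdifferentiableAt_totalSpace _ _).1 hZ).2.congr_of_eventuallyEq
      (hb.mono fun y hy ↦ ?_)
    simp only [Trivialization.continuousLinearMapAt_apply]
    rw [Trivialization.coe_linearMapAt_of_mem _ hy]
  have hcov := (leviCivita I M).isCovariantDerivativeOnUniv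
  have ht : TensorialAt I E (fun Z : Π y : M, TangentSpace I y ↦ leviCivita I M Z x -
      (e.symmL ℝ x).comp (mvfderiv I (fun y ↦ e.continuousLinearMapAt ℝ y (Z y)) x)) x :=
    { smul := by
        intro f Z hf hZ
        have h1 := hcov.leibniz hZ hf
        have h2 : mvfderiv I (fun y ↦ e.continuousLinearMapAt ℝ y ((f • Z) y)) x =
            mvfderiv I (f • fun y ↦ e.continuousLinearMapAt ℝ y (Z y)) x := by
          congr 1; ext y; simp
        have h3 : e.symmL ℝ x (e.continuousLinearMapAt ℝ x (Z x)) = Z x :=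
          e.symmL_continuousLinearMapAt hx _
        have h1' : leviCivita I M (f • Z) x = _ := h1
        simp only [h1', h2, mvfderiv_smul hf (hcoord hZ)]
        ext u
        simp only [Trivialization.continuousLinearMapAt_apply] at h3
        simp
        rw [h3]
        module
      add := by
        intro Z Z' hZ hZ'
        have h1 : leviCivita I M (Z + Z') x = _ := hcov.add hZ hZ'
        have h2 : mvfderiv I (fun y ↦ e.continuousLinearMapAt ℝ y ((Z + Z') y)) x =
            mvfderiv I ((fun y ↦ e.continuousLinearMapAt ℝ y (Z y)) +
              fun y ↦ e.continuousLinearMapAt ℝ y (Z' y)) x := by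
          congr 1; ext y; simp
        simp only [h1, h2, mvfderiv_add (hcoord hZ) (hcoord hZ')]
        ext u
        simp
        module }
  have h := ht.pointwise hY (mdifferentiableAt_extend I E (Y x)) (extend_apply_self E _).symm
  have h0 : mvfderiv I (fun y ↦ e.continuousLinearMapAt ℝ y (extend E (Y x) y)) x = 0 := by
    rw [← mvfderiv_const (I := I) (M := M) (e ⟨x, Y x⟩).2 (x := x)]
    simp only [mvfderiv]
    congr 1
    refine Filter.EventuallyEq.mfderiv_eq (hb.mono fun y hy ↦ ?_)
    simp only [extend]
    rw [← he, ← Trivialization.symmL_apply (R := ℝ) _ hy, e.continuousLinearMapAt_symmL hy]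
  rw [h0] at h
  simp only [ContinuousLinearMap.comp_zero, sub_zero] at h
  rw [← h]
  abel

/-- Along the restriction of a vector field `Y` of `M`, `derivAlong` is `u ↦ ∇_{F_* u} Y`. -/
theorem derivAlong_comp {F : N → M} {x : N} (hF : MDifferentiableAt I' I F x)
    {Y : Π y : M, TangentSpace I y} (hY : MDiffAt (T% Y) (F x)) :
    derivAlong I I' F (fun y ↦ Y (F y)) x =
      (leviCivita I M Y (F x)).comp (mfderiv I' I F x) := by
  rw [leviCivita_eq_derivAlong_id hY]
  have hb : ∀ᶠ y in nhds (F x), y ∈ (trivializationAt E (TangentSpace I : M → Type _) (F x)).baseSet :=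
    (trivializationAt E (TangentSpace I : M → Type _) (F x)).open_baseSet.mem_nhds
      (mem_baseSet_trivializationAt' _)
  have hc : MDifferentiableAt I 𝓘(ℝ, E) (fun y ↦
      (trivializationAt E (TangentSpace I : M → Type _) (F x)).continuousLinearMapAt ℝ y (Y y))
      (F x) := by
    refine ((mdifferentiableAt_totalSpace _ _).1 hY).2.congr_of_eventuallyEq
      (hb.mono fun y hy ↦ ?_)
    simp only [Trivialization.continuousLinearMapAt_apply]
    rw [Trivialization.coe_linearMapAt_of_mem _ hy]
  ext u
  have h := congrArg (fun L ↦ L u) (mfderiv_comp x hc hF)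
  simp only [Function.comp_def] at h
  simp only [derivAlong, mvfderiv, add_apply, ContinuousLinearMap.comp_apply]
  congr 2

variable (I I') in
/-- The second fundamental form `h(u, w)`: the normal part of `∇_{F_* u} (F_* W)`, where the vector
field `W` near `x` extends `w`. -/
def secondFundamentalForm (F : N → M) (x : N) (u w : TangentSpace I' x) : TangentSpace I (F x) :=
  (tangentRange I I' F x)ᗮ.starProjection
    (derivAlong I I' F (fun y ↦ mfderiv I' I F y (extend E' w y)) x u)

variable (I I') in
/-- The shape operator `A_ξ u`: the vector `a` tangent to `N` with `⟨a, w⟩ = ⟨h(u, w), ξ⟩` for all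
`w` tangent to `N`, in the metric induced by `F`. It exists and is unique when `F` is an
immersion, see `existsUnique_shapeOperator`. -/
def shapeOperator (F : N → M) (x : N) (ξ : TangentSpace I (F x)) (u : TangentSpace I' x) :
    TangentSpace I' x :=
  Classical.epsilon fun a ↦ ∀ w : TangentSpace I' x,
    inner ℝ (mfderiv I' I F x a) (mfderiv I' I F x w) =
      inner ℝ (secondFundamentalForm I I' F x u w) ξ


theorem mdifferentiableAt_push {F : N → M} (hF : ContMDiff I' I ∞ F) {x : N}
    {W : Π y : N, TangentSpace I' y} (hW : MDiffAt (T% W) x) :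
    MDifferentiableAt I' 𝓘(ℝ, E) (fun y ↦
      (trivializationAt E (TangentSpace I : M → Type _) (F x)).continuousLinearMapAt ℝ (F y)
        (mfderiv I' I F y (W y))) x := by
  have h1 : ContMDiff I'.tangent I.tangent 1 (tangentMap I' I F) :=
    hF.contMDiff_tangentMap (by norm_num; exact ENat.LEInfty.out)
  have h2 : MDifferentiableAt I' I.tangent
      (fun y ↦ (⟨F y, mfderiv I' I F y (W y)⟩ : TangentBundle I M)) x :=
    ((h1 ⟨x, W x⟩).mdifferentiableAt one_ne_zero).comp x hW
  have h3 := ((mdifferentiableAt_totalSpace _ _).1 h2).2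
  have hb : ∀ᶠ y in nhds x, F y ∈ (trivializationAt E (TangentSpace I : M → Type _) (F x)).baseSet :=
    hF.continuous.continuousAt.preimage_mem_nhds
      ((trivializationAt E (TangentSpace I : M → Type _) (F x)).open_baseSet.mem_nhds
        (mem_baseSet_trivializationAt' (F x)))
  refine h3.congr_of_eventuallyEq (hb.mono fun y hy ↦ ?_)
  simp only [Trivialization.continuousLinearMapAt_apply]
  rw [Trivialization.coe_linearMapAt_of_mem _ hy]

theorem leviCivita_extend_linear {x : M} (a b : ℝ) (u v : TangentSpace I x) :
    leviCivita I M (extend E (a • u + b • v)) x =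
      a • leviCivita I M (extend E u) x + b • leviCivita I M (extend E v) x := by
  have hu := mdifferentiableAt_extend I E u
  have hv := mdifferentiableAt_extend I E v
  have hau : MDiffAt (T% (a • extend E u)) x := mdifferentiableAt_const.smul_section hu
  have hbv : MDiffAt (T% (b • extend E v)) x := mdifferentiableAt_const.smul_section hv
  have hcov := (leviCivita I M).isCovariantDerivativeOnUniv
  have h1 := hcov.congr_of_eventuallyEq (mdifferentiableAt_extend I E (a • u + b • v))
    (mdifferentiableAt_add_section hau hbv) Filter.univ_mem (extend_eventually_linear a b u v)
  have h2 := hcov.add hau hbv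
  have h3 := hcov.smul_const a hu
  have h4 := hcov.smul_const b hv
  exact h1.trans (h2.trans (by rw [h3, h4]))

theorem derivAlong_linear {F : N → M} {x : N} {r s t : Π y : N, TangentSpace I (F y)} (a b : ℝ)
    (hs : MDifferentiableAt I' 𝓘(ℝ, E) (fun y ↦
      (trivializationAt E (TangentSpace I : M → Type _) (F x)).continuousLinearMapAt ℝ (F y)
        (s y)) x)
    (ht : MDifferentiableAt I' 𝓘(ℝ, E) (fun y ↦
      (trivializationAt E (TangentSpace I : M → Type _) (F x)).continuousLinearMapAt ℝ (F y)
        (t y)) x)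
    (hr : ∀ᶠ y in nhds x, r y = a • s y + b • t y) :
    derivAlong I I' F r x = a • derivAlong I I' F s x + b • derivAlong I I' F t x := by
  have hd : mvfderiv I' (fun y ↦
      (trivializationAt E (TangentSpace I : M → Type _) (F x)).continuousLinearMapAt ℝ (F y)
        (r y)) x = mvfderiv I' ((fun _ : N ↦ a) • (fun y ↦
      (trivializationAt E (TangentSpace I : M → Type _) (F x)).continuousLinearMapAt ℝ (F y)
        (s y)) + (fun _ : N ↦ b) • (fun y ↦
      (trivializationAt E (TangentSpace I : M → Type _) (F x)).continuousLinearMapAt ℝ (F y)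
        (t y))) x := by
    simp only [mvfderiv]
    congr 1
    refine Filter.EventuallyEq.mfderiv_eq (hr.mono fun y hy ↦ ?_)
    simp [hy]
  simp only [derivAlong]
  rw [hd, mvfderiv_add (mdifferentiableAt_const.smul hs) (mdifferentiableAt_const.smul ht),
    mvfderiv_smul mdifferentiableAt_const hs, mvfderiv_smul mdifferentiableAt_const ht,
    hr.self_of_nhds, leviCivita_extend_linear]
  have h0 (c : ℝ) : mvfderiv I' (fun _ : N ↦ c) x = 0 := mvfderiv_const c
  ext u
  simp [h0]
  module

theorem secondFundamentalForm_linear {F : N → M} (hF : ContMDiff I' I ∞ F) (x : N) (a b : ℝ)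
    (u v w : TangentSpace I' x) :
    secondFundamentalForm I I' F x u (a • v + b • w) =
      a • secondFundamentalForm I I' F x u v + b • secondFundamentalForm I I' F x u w := by
  simp only [secondFundamentalForm]
  rw [derivAlong_linear a b (mdifferentiableAt_push hF (mdifferentiableAt_extend I' E' v))
    (mdifferentiableAt_push hF (mdifferentiableAt_extend I' E' w))
    ((extend_eventually_linear a b v w).mono fun y hy ↦ by rw [hy]; simp)]
  simp
  module

theorem existsUnique_shapeOperator {F : N → M} (hF : ContMDiff I' I ∞ F) (x : N)
    (hinj : Function.Injective (mfderiv I' I F x)) (ξ : TangentSpace I (F x))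
    (u : TangentSpace I' x) :
    ∃! a : TangentSpace I' x, ∀ w : TangentSpace I' x,
      inner ℝ (mfderiv I' I F x a) (mfderiv I' I F x w) =
        inner ℝ (secondFundamentalForm I I' F x u w) ξ := by
  let d : TangentSpace I' x →ₗ[ℝ] TangentSpace I (F x) := (mfderiv I' I F x).toLinearMap
  let Φ : TangentSpace I' x →ₗ[ℝ] Module.Dual ℝ (TangentSpace I' x) :=
    LinearMap.mk₂ ℝ (fun a w ↦ inner ℝ (d a) (d w))
      (by intros; simp [inner_add_left]) (by intros; simp [inner_smul_left])
      (by intros; simp [inner_add_right]) (by intros; simp [inner_smul_right])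
  let φ : Module.Dual ℝ (TangentSpace I' x) :=
    { toFun := fun w ↦ inner ℝ (secondFundamentalForm I I' F x u w) ξ
      map_add' := by
        intro v w
        have := secondFundamentalForm_linear hF x 1 1 u v w
        simp only [one_smul] at this
        rw [this, inner_add_left]
      map_smul' := by
        intro c v
        have := secondFundamentalForm_linear hF x c 0 u v 0
        simp only [zero_smul, add_zero] at this
        rw [this, inner_smul_left]; simp }
  have hΦ : Function.Injective Φ := by
    rw [injective_iff_map_eq_zero]
    intro a ha
    have h : inner ℝ (d a) (d a) = 0 := congrArg (fun ψ ↦ ψ a) ha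
    exact hinj ((inner_self_eq_zero.1 h).trans (map_zero d).symm)
  have hb : Function.Bijective Φ :=
    ⟨hΦ, (LinearMap.injective_iff_surjective_of_finrank_eq_finrank
      (Subspace.dual_finrank_eq).symm).1 hΦ⟩
  obtain ⟨a, ha, hu⟩ := hb.existsUnique φ
  exact ⟨a, fun w ↦ congrArg (fun ψ ↦ ψ w) ha, fun a' ha' ↦ hu a' (LinearMap.ext ha')⟩

theorem shapeOperator_spec {F : N → M} (hF : ContMDiff I' I ∞ F) (x : N)
    (hinj : Function.Injective (mfderiv I' I F x)) (ξ : TangentSpace I (F x))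
    (u w : TangentSpace I' x) :
    inner ℝ (mfderiv I' I F x (shapeOperator I I' F x ξ u)) (mfderiv I' I F x w) =
      inner ℝ (secondFundamentalForm I I' F x u w) ξ :=
  Classical.epsilon_spec (existsUnique_shapeOperator hF x hinj ξ u).exists w

variable (I I') in
/-- The tangential part `(J ξ)^T` for `ξ ∈ T_{F x} M`. On `ξ = F_* u` this is `T u`. -/
def tangentialPart (J : Π y : M, TangentSpace I y →L[ℝ] TangentSpace I y) (F : N → M) (x : N)
    (ξ : TangentSpace I (F x)) : TangentSpace I (F x) :=
  (tangentRange I I' F x).starProjection (J (F x) ξ)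

variable (I I') in
/-- The normal part `(J ξ)^⊥` for `ξ ∈ T_{F x} M`. On `ξ = F_* u` this is `N u`. -/
def normalPart (J : Π y : M, TangentSpace I y →L[ℝ] TangentSpace I y) (F : N → M) (x : N)
    (ξ : TangentSpace I (F x)) : TangentSpace I (F x) :=
  (tangentRange I I' F x)ᗮ.starProjection (J (F x) ξ)

/-- `(M, g, J)` is a metallic Riemannian manifold: `J` is a smooth `(1,1)`-tensor field with
`J² = p J + q I`, symmetric for the metric of `M`, where `p` and `q` are positive integers. -/
structure IsMetallic (p q : ℕ) (J : Π y : M, TangentSpace I y →L[ℝ] TangentSpace I y) : Prop where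
  p_pos : 0 < p
  q_pos : 0 < q
  smooth : ContMDiff I (I.prod 𝓘(ℝ, E →L[ℝ] E)) ∞ (fun y ↦
    TotalSpace.mk' (E →L[ℝ] E) (E := fun y : M ↦ TangentSpace I y →L[ℝ] TangentSpace I y) y (J y))
  sq : ∀ (y : M) (v : TangentSpace I y), J y (J y v) = (p : ℝ) • J y v + (q : ℝ) • v
  symm : ∀ (y : M) (v w : TangentSpace I y), inner ℝ (J y v) w = inner ℝ v (J y w)

/-- A metallic Riemannian manifold is locally metallic if `∇J = 0`, i.e. `∇_u (J Y) = J (∇_u Y)`. -/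
structure IsLocallyMetallic (p q : ℕ) (J : Π y : M, TangentSpace I y →L[ℝ] TangentSpace I y) :
    Prop extends IsMetallic p q J where
  parallel : ∀ (y : M) (Y : Π y : M, TangentSpace I y), MDiffAt (T% Y) y →
    ∀ u : TangentSpace I y,
      leviCivita I M (fun y' ↦ J y' (Y y')) y u = J y (leviCivita I M Y y u)

variable (I I') in
/-- The immersed submanifold `F : N → M` is pointwise slant with Wirtinger function `θ`: for each
`x`, the angle between `J u` and `T_x N` equals `θ x` for all nonzero `u ∈ T_x N`. -/
def IsPointwiseSlant (J : Π y : M, TangentSpace I y →L[ℝ] TangentSpace I y) (F : N → M)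
    (θ : N → ℝ) : Prop :=
  ∀ x : N, θ x ∈ Set.Icc 0 (Real.pi / 2) ∧ ∀ u : TangentSpace I' x, u ≠ 0 →
    Real.cos (θ x) = ‖tangentialPart I I' J F x (mfderiv I' I F x u)‖ /
      ‖J (F x) (mfderiv I' I F x u)‖

variable (I I') in
/-- The immersed submanifold `F : N → M` is invariant: `J (T_x N) ⊆ T_x N` for each `x`. -/
def IsInvariantSubmanifold (J : Π y : M, TangentSpace I y →L[ℝ] TangentSpace I y) (F : N → M) :
    Prop :=
  ∀ (x : N) (u : TangentSpace I' x),
    J (F x) (mfderiv I' I F x u) ∈ tangentRange I I' F x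

end Submanifold

section WarpedProduct

variable {E₁ : Type*} [NormedAddCommGroup E₁] [NormedSpace ℝ E₁]
  {H₁ : Type*} [TopologicalSpace H₁] (I₁ : ModelWithCorners ℝ E₁ H₁)
  {M₁ : Type*} [TopologicalSpace M₁] [ChartedSpace H₁ M₁]
  {E₂ : Type*} [NormedAddCommGroup E₂] [NormedSpace ℝ E₂]
  {H₂ : Type*} [TopologicalSpace H₂] (I₂ : ModelWithCorners ℝ E₂ H₂)
  {M₂ : Type*} [TopologicalSpace M₂] [ChartedSpace H₂ M₂]

/-- The warped product metric `g = π₁^* g₁ + (f ∘ π₁)² π₂^* g₂` on `M₁ × M₂`. -/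
def warpedMetric [RiemannianBundle (fun x : M₁ ↦ TangentSpace I₁ x)]
    [RiemannianBundle (fun y : M₂ ↦ TangentSpace I₂ y)] (f : M₁ → ℝ) (z : M₁ × M₂)
    (v w : TangentSpace (I₁.prod I₂) z) : ℝ :=
  inner ℝ (mfderiv (I₁.prod I₂) I₁ Prod.fst z v) (mfderiv (I₁.prod I₂) I₁ Prod.fst z w)
    + f z.1 ^ 2 *
      inner ℝ (mfderiv (I₁.prod I₂) I₂ Prod.snd z v) (mfderiv (I₁.prod I₂) I₂ Prod.snd z w)

/-- The distribution on `M₁ × M₂` of the vectors tangent to `M₁`. -/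
def baseDistribution (z : M₁ × M₂) : Submodule ℝ (TangentSpace (I₁.prod I₂) z) :=
  LinearMap.ker (mfderiv (I₁.prod I₂) I₂ (Prod.snd : M₁ × M₂ → M₂) z).toLinearMap

variable {E : Type*} [NormedAddCommGroup E] [NormedSpace ℝ E] [FiniteDimensional ℝ E]
  {H : Type*} [TopologicalSpace H] (I : ModelWithCorners ℝ E H)
  {M : Type*} [TopologicalSpace M] [ChartedSpace H M] [IsManifold I ∞ M]
  [RiemannianBundle (fun x : M ↦ TangentSpace I x)]
  [IsContMDiffRiemannianBundle I ∞ E (fun x : M ↦ TangentSpace I x)]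

/-- The operator `T₁ = P₁ ∘ T` of `F : M₁ × M₂ → M`, for `ξ ∈ T_{F z} M`, where `P₁` is the
projection of `T(M₁ × M₂)` onto the vectors tangent to `M₁` (all identified with their images under
`F_*`; `P₁` is orthogonal, as `TM₁` and `TM₂` are orthogonal in a warped product). -/
def baseTangentialPart (J : Π y : M, TangentSpace I y →L[ℝ] TangentSpace I y)
    (F : M₁ × M₂ → M) (z : M₁ × M₂) (ξ : TangentSpace I (F z)) : TangentSpace I (F z) :=
  ((baseDistribution I₁ I₂ z).map (mfderiv (I₁.prod I₂) I F z).toLinearMap).starProjection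
    (tangentialPart I (I₁.prod I₂) J F z ξ)

/-- `F : M₁ × M₂ → M` exhibits the warped product `M₁ ×_f M₂` as a warped product pointwise
semi-slant submanifold of `(M, g, J)` of the form `M_θ ×_f M_T`: `f` is a positive smooth function
on `M₁`, `F` is a smooth isometric immersion for the warped product metric, `M₁` (i.e. each leaf
`M₁ × {y}`) is a pointwise slant submanifold with Wirtinger function `θ`, and `M₂` (i.e. each leaf
`{x} × M₂`) is an invariant submanifold. -/
structure IsWarpedProductSemiSlant [RiemannianBundle (fun x : M₁ ↦ TangentSpace I₁ x)]
    [RiemannianBundle (fun y : M₂ ↦ TangentSpace I₂ y)]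
    (J : Π y : M, TangentSpace I y →L[ℝ] TangentSpace I y)
    (f : M₁ → ℝ) (F : M₁ × M₂ → M) (θ : M₁ × M₂ → ℝ) : Prop where
  warping_smooth : ContMDiff I₁ 𝓘(ℝ, ℝ) ∞ f
  warping_pos : ∀ x, 0 < f x
  smooth : ContMDiff (I₁.prod I₂) I ∞ F
  isometric : ∀ (z : M₁ × M₂) (v w : TangentSpace (I₁.prod I₂) z),
    inner ℝ (mfderiv (I₁.prod I₂) I F z v) (mfderiv (I₁.prod I₂) I F z w) =
      warpedMetric I₁ I₂ f z v w
  slant : ∀ y : M₂, IsPointwiseSlant I I₁ J (fun x ↦ F (x, y)) (fun x ↦ θ (x, y))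
  invariant : ∀ x : M₁, IsInvariantSubmanifold I I₂ J (fun y ↦ F (x, y))

end WarpedProduct

end

/-!
Write `∇` for `derivAlong`, the pullback of the Levi-Civita connection by `F`. For `X` and `W`
tangent to the slant leaves and `Z` tangent to the invariant leaves, `⟨h(X, Z), N W⟩ = 0`. Hence
each of `A_{N T₁ Y} X` and `A_{N T₁ X} Y` is orthogonal to the invariant leaves, that is, tangent to
the slant leaves, and so is their difference.

The identity rests on the fact that the slant leaves are totally geodesic in the warped product:
`⟨∇_X F_* W, F_* Z⟩ = 0` (`inner_derivAlong_extend_eq_zero`). For fields `X`, `W`, `Z` constant in a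
product chart this is the formula for the Christoffel symbols, since `⟨W, Z⟩ = ⟨X, Z⟩ = 0` and
`⟨X, W⟩` is constant along the invariant leaves. As `∇` is compatible with the metric, it follows
that `⟨∇_X s, F_* W⟩ = 0` for every field `s` along `F` tangent to the invariant leaves.

The normal part of `J W` is `N W = J W - T W`, and `T W` is tangent to the slant leaves because `J`
is symmetric and preserves the tangent spaces of the invariant leaves. So
`⟨h(X, Z), N W⟩ = ⟨∇_X F_* Z, J W⟩ - ⟨∇_X F_* Z, T W⟩`. The second term vanishes by the above with
`s = F_* Z`. The first is `⟨∇_X (J F_* Z), W⟩`, as `J` is symmetric and parallel, and vanishes by the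
above with `s = J F_* Z`. This is `IsWarpedProductSemiSlant.inner_secondFundamentalForm_normalPart`.

The calculus of fields along `F` comes from `MDiffAlongAt.induction`: they are locally generated,
over functions on the source, by restrictions of fields of the target, so that metric compatibility
and `∇J = 0` carry over from the target. The role of torsion-freeness is played by
`derivAlong_extend_comm`, from the symmetry of second derivatives in charts.
-/

noncomputable section

/-! ### Differentiation of vector fields along a map -/

section Along

variable {E : Type*} [NormedAddCommGroup E] [NormedSpace ℝ E] [FiniteDimensional ℝ E]
  {H : Type*} [TopologicalSpace H] {I : ModelWithCorners ℝ E H}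
  {M : Type*} [TopologicalSpace M] [ChartedSpace H M] [IsManifold I ∞ M]
  [RiemannianBundle (fun x : M ↦ TangentSpace I x)]
  [IsContMDiffRiemannianBundle I ∞ E (fun x : M ↦ TangentSpace I x)]
  {E' : Type*} [NormedAddCommGroup E'] [NormedSpace ℝ E'] [FiniteDimensional ℝ E']
  {H' : Type*} [TopologicalSpace H'] {I' : ModelWithCorners ℝ E' H'}
  {N : Type*} [TopologicalSpace N] [ChartedSpace H' N] [IsManifold I' ∞ N]

variable (I I') in
/-- A vector field `s` along `F : N → M` is differentiable at `x`. This is differentiability of its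
coordinates in the preferred trivialization of `TM` at `F x`, as in the definition of
`derivAlong`. -/
def MDiffAlongAt (F : N → M) (s : Π y : N, TangentSpace I (F y)) (x : N) : Prop :=
  MDifferentiableAt I' 𝓘(ℝ, E) (fun y ↦
    (trivializationAt E (TangentSpace I : M → Type _) (F x)).continuousLinearMapAt ℝ (F y)
      (s y)) x

variable {F : N → M} {x : N} {s t : Π y : N, TangentSpace I (F y)}

theorem MDiffAlongAt.congr (hs : MDiffAlongAt I I' F s x) (h : ∀ᶠ y in nhds x, t y = s y) :
    MDiffAlongAt I I' F t x :=
  MDifferentiableAt.congr_of_eventuallyEq hs (h.mono fun y hy ↦ by simp only [hy])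

theorem MDiffAlongAt.add (hs : MDiffAlongAt I I' F s x) (ht : MDiffAlongAt I I' F t x) :
    MDiffAlongAt I I' F (fun y ↦ s y + t y) x := by
  have h := MDifferentiableAt.add hs ht
  simp only [MDiffAlongAt, map_add]
  exact h

theorem MDiffAlongAt.smul {g : N → ℝ} (hg : MDifferentiableAt I' 𝓘(ℝ, ℝ) g x)
    (hs : MDiffAlongAt I I' F s x) : MDiffAlongAt I I' F (fun y ↦ g y • s y) x := by
  have h := MDifferentiableAt.smul hg hs
  simp only [MDiffAlongAt, map_smul]
  exact h

theorem MDiffAlongAt.comp (hF : MDifferentiableAt I' I F x) {Y : Π y : M, TangentSpace I y}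
    (hY : MDiffAt (T% Y) (F x)) : MDiffAlongAt I I' F (fun y ↦ Y (F y)) x := by
  have hb : ∀ᶠ y in nhds (F x),
      y ∈ (trivializationAt E (TangentSpace I : M → Type _) (F x)).baseSet :=
    (trivializationAt E (TangentSpace I : M → Type _) (F x)).open_baseSet.mem_nhds
      (mem_baseSet_trivializationAt' _)
  have hc : MDifferentiableAt I 𝓘(ℝ, E) (fun y ↦
      (trivializationAt E (TangentSpace I : M → Type _) (F x)).continuousLinearMapAt ℝ y (Y y))
      (F x) := by
    refine ((mdifferentiableAt_totalSpace _ _).1 hY).2.congr_of_eventuallyEq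
      (hb.mono fun y hy ↦ ?_)
    simp only [Trivialization.continuousLinearMapAt_apply]
    rw [Trivialization.coe_linearMapAt_of_mem _ hy]
  exact MDifferentiableAt.comp x hc hF

theorem mvfderiv_congr {V : Type*} [NormedAddCommGroup V] [NormedSpace ℝ V] {f g : N → V}
    (h : f =ᶠ[nhds x] g) : mvfderiv I' f x = mvfderiv I' g x := by
  simp only [mvfderiv, h.mfderiv_eq]
  rfl

theorem derivAlong_congr (h : ∀ᶠ y in nhds x, t y = s y) :
    derivAlong I I' F t x = derivAlong I I' F s x := by
  simp only [derivAlong, h.self_of_nhds]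
  congr 2
  exact mvfderiv_congr (h.mono fun y hy ↦ by simp only [hy])

theorem derivAlong_add (hs : MDiffAlongAt I I' F s x) (ht : MDiffAlongAt I I' F t x)
    (u : TangentSpace I' x) :
    derivAlong I I' F (fun y ↦ s y + t y) x u =
      derivAlong I I' F s x u + derivAlong I I' F t x u := by
  have h := derivAlong_linear (r := fun y ↦ s y + t y) 1 1 hs ht
    (Filter.Eventually.of_forall fun y ↦ by simp)
  rw [h]
  simp

theorem derivAlong_smul {g : N → ℝ} (hg : MDifferentiableAt I' 𝓘(ℝ, ℝ) g x)
    (hs : MDiffAlongAt I I' F s x) (u : TangentSpace I' x) :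
    derivAlong I I' F (fun y ↦ g y • s y) x u =
      mvfderiv I' g x u • s x + g x • derivAlong I I' F s x u := by
  have hx : F x ∈ (trivializationAt E (TangentSpace I : M → Type _) (F x)).baseSet :=
    mem_baseSet_trivializationAt' _
  have h1 := leviCivita_extend_linear (M := M) (I := I) (g x) 0 (s x) 0
  simp only [zero_smul, add_zero] at h1
  have h2 := mvfderiv_smul hg hs
  have h3 := (trivializationAt E (TangentSpace I : M → Type _) (F x)).symmL_continuousLinearMapAt
    (R := ℝ) hx (s x)
  have h4 : (fun y ↦ (trivializationAt E (TangentSpace I : M → Type _)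
      (F x)).continuousLinearMapAt ℝ (F y) (g y • s y)) = g • fun y ↦
        (trivializationAt E (TangentSpace I : M → Type _) (F x)).continuousLinearMapAt ℝ (F y)
          (s y) := by
    ext y; simp
  simp only [derivAlong]
  rw [h4, h2, h1]
  simp only [add_apply, ContinuousLinearMap.comp_apply, smul_apply,
    ContinuousLinearMap.smulRight_apply, map_add, map_smul, h3]
  module

/-- Vector fields along `F` are locally combinations, with function coefficients, of restrictions
of vector fields of `M`: a property of differentiable fields along `F` that holds for
restrictions and is stable under these operations holds for all of them. -/
theorem MDiffAlongAt.induction {P : (Π y : N, TangentSpace I (F y)) → Prop}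
    (hF : MDifferentiableAt I' I F x)
    (comp : ∀ Y : Π y : M, TangentSpace I y, MDiffAt (T% Y) (F x) → P (fun y ↦ Y (F y)))
    (smul : ∀ (g : N → ℝ) (s : Π y : N, TangentSpace I (F y)),
      MDifferentiableAt I' 𝓘(ℝ, ℝ) g x → MDiffAlongAt I I' F s x → P s → P (fun y ↦ g y • s y))
    (add : ∀ s t : Π y : N, TangentSpace I (F y), MDiffAlongAt I I' F s x →
      MDiffAlongAt I I' F t x → P s → P t → P (fun y ↦ s y + t y))
    (congr : ∀ s t : Π y : N, TangentSpace I (F y), (∀ᶠ y in nhds x, t y = s y) → P s → P t)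
    (hs : MDiffAlongAt I I' F s x) : P s := by
  set e := trivializationAt E (TangentSpace I : M → Type _) (F x) with he
  let b := Module.finBasis ℝ E
  let Y (i : Fin (Module.finrank ℝ E)) : Π y : M, TangentSpace I y :=
    extend E (e.symmL ℝ (F x) (b i))
  let g (i : Fin (Module.finrank ℝ E)) (y : N) : ℝ :=
    b.repr (e.continuousLinearMapAt ℝ (F y) (s y)) i
  have hY i : MDiffAt (T% (Y i)) (F x) := mdifferentiableAt_extend I E _
  have hg i : MDifferentiableAt I' 𝓘(ℝ, ℝ) (g i) x := by
    have h : MDifferentiableAt 𝓘(ℝ, E) 𝓘(ℝ, ℝ) (LinearMap.toContinuousLinearMap (b.coord i))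
        (e.continuousLinearMapAt ℝ (F x) (s x)) :=
      (ContinuousLinearMap.differentiableAt _).mdifferentiableAt
    exact h.comp x hs
  have hsum (T : Finset (Fin (Module.finrank ℝ E))) :
      MDiffAlongAt I I' F (fun y ↦ ∑ i ∈ T, g i y • Y i (F y)) x ∧
        P (fun y ↦ ∑ i ∈ T, g i y • Y i (F y)) := by
    induction T using Finset.induction_on with
    | empty =>
      simp only [Finset.sum_empty]
      have h0 : MDiffAt (T% (fun _ ↦ 0 : Π y : M, TangentSpace I y)) (F x) :=
        mdifferentiableAt_zeroSection ..
      exact ⟨.comp hF h0, comp _ h0⟩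
    | insert i T hi ih =>
      simp only [Finset.sum_insert hi]
      have hc := MDiffAlongAt.comp hF (hY i)
      exact ⟨(hc.smul (hg i)).add ih.1,
        add _ _ (hc.smul (hg i)) ih.1 (smul _ _ (hg i) hc (comp _ (hY i))) ih.2⟩
  have hx : F x ∈ e.baseSet := mem_baseSet_trivializationAt' _
  refine congr _ _ ?_ (hsum Finset.univ).2
  filter_upwards [hF.continuousAt.preimage_mem_nhds (e.open_baseSet.mem_nhds hx)]
    with y (hy : F y ∈ e.baseSet)
  have hYy i : Y i (F y) = e.symmL ℝ (F y) (b i) := by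
    simp only [Y, extend, ← he]
    rw [Trivialization.symmL_apply (R := ℝ) _ hy]
    congr 1
    have := e.continuousLinearMapAt_symmL (R := ℝ) hx (b i)
    rwa [Trivialization.continuousLinearMapAt_apply, Trivialization.coe_linearMapAt_of_mem _ hx]
      at this
  simp only [hYy, ← map_smul, ← map_sum, g, b.sum_repr]
  exact (e.symmL_continuousLinearMapAt hy _).symm

/-- The derivative along `F` is compatible with the metric. -/
theorem mvfderiv_inner_along (hF : MDifferentiableAt I' I F x) (hs : MDiffAlongAt I I' F s x)
    (ht : MDiffAlongAt I I' F t x) :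
    MDifferentiableAt I' 𝓘(ℝ, ℝ) (fun y ↦ inner ℝ (s y) (t y)) x ∧ ∀ u : TangentSpace I' x,
      mvfderiv I' (fun y ↦ inner ℝ (s y) (t y)) x u =
        inner ℝ (derivAlong I I' F s x u) (t x) + inner ℝ (s x) (derivAlong I I' F t x u) := by
  refine MDiffAlongAt.induction (P := fun s ↦
    MDifferentiableAt I' 𝓘(ℝ, ℝ) (fun y ↦ inner ℝ (s y) (t y)) x ∧ ∀ u : TangentSpace I' x,
      mvfderiv I' (fun y ↦ inner ℝ (s y) (t y)) x u =
        inner ℝ (derivAlong I I' F s x u) (t x) + inner ℝ (s x) (derivAlong I I' F t x u))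
    hF ?_ ?_ ?_ ?_ hs
  · intro Y hY
    refine MDiffAlongAt.induction (P := fun t ↦
      MDifferentiableAt I' 𝓘(ℝ, ℝ) (fun y ↦ inner ℝ (Y (F y)) (t y)) x ∧
      ∀ u : TangentSpace I' x, mvfderiv I' (fun y ↦ inner ℝ (Y (F y)) (t y)) x u =
        inner ℝ (derivAlong I I' F (fun y ↦ Y (F y)) x u) (t x) +
          inner ℝ (Y (F x)) (derivAlong I I' F t x u))
      hF ?_ ?_ ?_ ?_ ht
    · intro Z hZ
      have hd := mdifferentiableAt_inner hY hZ
      refine ⟨hd.comp x hF, fun u ↦ ?_⟩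
      rw [derivAlong_comp hF hY, derivAlong_comp hF hZ]
      have hu := mdifferentiableAt_extend I E (mfderiv I' I F x u)
      have h := leviCivita_inner hu hY hZ
      simp only [extend_apply_self] at h
      rw [ContinuousLinearMap.comp_apply, ContinuousLinearMap.comp_apply, ← h]
      exact mvfderiv_comp_apply x hd hF u
    · intro g t hg ht ih
      simp only [inner_smul_right]
      refine ⟨hg.mul ih.1, fun u ↦ ?_⟩
      rw [mvfderiv_fun_mul hg ih.1, derivAlong_smul hg ht]
      simp only [add_apply, smul_apply, ih.2, inner_add_right, inner_smul_right, smul_eq_mul]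
      ring
    · intro t t' ht ht' ih ih'
      simp only [inner_add_right]
      refine ⟨ih.1.add ih'.1, fun u ↦ ?_⟩
      rw [mvfderiv_fun_add ih.1 ih'.1, derivAlong_add ht ht']
      simp only [add_apply, ih.2, ih'.2, inner_add_right]
      ring
    · intro t t' h ih
      have h' : (fun y ↦ inner ℝ (Y (F y)) (t' y)) =ᶠ[nhds x] fun y ↦ inner ℝ (Y (F y)) (t y) :=
        h.mono fun y hy ↦ by simp only [hy]
      refine ⟨ih.1.congr_of_eventuallyEq h', fun u ↦ ?_⟩
      rw [derivAlong_congr h, h.self_of_nhds, ← ih.2]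
      rw [mvfderiv_congr h']
  · intro g s hg hs ih
    simp only [inner_smul_left]
    refine ⟨hg.mul ih.1, fun u ↦ ?_⟩
    simp only [conj_trivial]
    rw [mvfderiv_fun_mul hg ih.1, derivAlong_smul hg hs]
    simp only [add_apply, smul_apply, ih.2, inner_add_left, inner_smul_left, smul_eq_mul,
      conj_trivial]
    ring
  · intro s s' hs hs' ih ih'
    simp only [inner_add_left]
    refine ⟨ih.1.add ih'.1, fun u ↦ ?_⟩
    rw [mvfderiv_fun_add ih.1 ih'.1, derivAlong_add hs hs']
    simp only [add_apply, ih.2, ih'.2, inner_add_left]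
    ring
  · intro s s' h ih
    have h' : (fun y ↦ inner ℝ (s' y) (t y)) =ᶠ[nhds x] fun y ↦ inner ℝ (s y) (t y) :=
      h.mono fun y hy ↦ by simp only [hy]
    refine ⟨ih.1.congr_of_eventuallyEq h', fun u ↦ ?_⟩
    rw [derivAlong_congr h, h.self_of_nhds, ← ih.2]
    rw [mvfderiv_congr h']

/-- A parallel tensor field `J` commutes with the derivative along `F`. -/
theorem IsLocallyMetallic.derivAlong_apply {p q : ℕ}
    {J : Π y : M, TangentSpace I y →L[ℝ] TangentSpace I y} (hJ : IsLocallyMetallic p q J)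
    (hF : MDifferentiableAt I' I F x) (hs : MDiffAlongAt I I' F s x) :
    MDiffAlongAt I I' F (fun y ↦ J (F y) (s y)) x ∧ ∀ u : TangentSpace I' x,
      derivAlong I I' F (fun y ↦ J (F y) (s y)) x u = J (F x) (derivAlong I I' F s x u) := by
  refine MDiffAlongAt.induction (P := fun s ↦
    MDiffAlongAt I I' F (fun y ↦ J (F y) (s y)) x ∧ ∀ u : TangentSpace I' x,
      derivAlong I I' F (fun y ↦ J (F y) (s y)) x u = J (F x) (derivAlong I I' F s x u))
    hF ?_ ?_ ?_ ?_ hs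
  · intro Y hY
    have hJY : MDiffAt (T% (fun y ↦ J y (Y y))) (F x) :=
      MDifferentiableAt.clm_bundle_apply (F₁ := E) (F₂ := E)
        ((hJ.smooth (F x)).mdifferentiableAt (by simp)) hY
    refine ⟨.comp hF hJY, fun u ↦ ?_⟩
    rw [derivAlong_comp hF hJY, derivAlong_comp hF hY]
    exact hJ.parallel _ Y hY _
  · intro g s hg hs ih
    simp only [map_smul]
    exact ⟨ih.1.smul hg, fun u ↦ by simp [derivAlong_smul hg ih.1, derivAlong_smul hg hs, ih.2]⟩
  · intro s t hs ht ih ih'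
    simp only [map_add]
    exact ⟨ih.1.add ih'.1,
      fun u ↦ by simp [derivAlong_add ih.1 ih'.1, derivAlong_add hs ht, ih.2, ih'.2]⟩
  · intro s t h ih
    have h' : ∀ᶠ y in nhds x, J (F y) (t y) = J (F y) (s y) := h.mono fun y hy ↦ by rw [hy]
    exact ⟨ih.1.congr h', fun u ↦ by rw [derivAlong_congr h', derivAlong_congr h, ih.2]⟩

end Along

/-! ### Symmetry of the derivative along a map -/

section Symmetry

variable {E : Type*} [NormedAddCommGroup E] [NormedSpace ℝ E] [FiniteDimensional ℝ E]
  {H : Type*} [TopologicalSpace H] {I : ModelWithCorners ℝ E H}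
  {M : Type*} [TopologicalSpace M] [ChartedSpace H M] [IsManifold I ∞ M]

theorem extend_eq_symmL {x y : M} (v : TangentSpace I x)
    (hy : y ∈ (trivializationAt E (TangentSpace I : M → Type _) x).baseSet) :
    extend E v y = (trivializationAt E (TangentSpace I : M → Type _) x).symmL ℝ y
      ((trivializationAt E (TangentSpace I : M → Type _) x).continuousLinearMapAt ℝ x v) := by
  simp only [extend]
  rw [Trivialization.symmL_apply (R := ℝ) _ hy, Trivialization.continuousLinearMapAt_apply,
    Trivialization.coe_linearMapAt_of_mem _ (mem_baseSet_trivializationAt' x)]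

/-- The fields `extend E u` are constant in the preferred chart at `x`, so they commute at `x`. -/
theorem mlieBracket_extend {x : M} (u v : TangentSpace I x) :
    mlieBracket I (extend E u) (extend E v) x = 0 := by
  have key (w : TangentSpace I x) : ∀ p ∈ (extChartAt I x).target,
      mpullbackWithin 𝓘(ℝ, E) I (extChartAt I x).symm (extend E w) (Set.range I) p =
        (trivializationAt E (TangentSpace I : M → Type _) x).continuousLinearMapAt ℝ x w := by
    intro p hp
    have hy : (extChartAt I x).symm p ∈ (chartAt H x).source := by
      have := (extChartAt I x).map_target hp
      rwa [extChartAt_source] at this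
    rw [mpullbackWithin_apply, extend_eq_symmL w (by simpa using hy),
      TangentBundle.symmL_trivializationAt hy, (extChartAt I x).right_inv hp]
    exact (isInvertible_mfderivWithin_extChartAt_symm hp).inverse_apply_self _
  have hev (w : TangentSpace I x) :
      mpullbackWithin 𝓘(ℝ, E) I (extChartAt I x).symm (extend E w) (Set.range I)
        =ᶠ[nhdsWithin (extChartAt I x x) (Set.range I)] fun _ ↦
        (trivializationAt E (TangentSpace I : M → Type _) x).continuousLinearMapAt ℝ x w :=
    Filter.eventuallyEq_of_mem (extChartAt_target_mem_nhdsWithin x) (key w)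
  rw [← mlieBracketWithin_univ, mlieBracketWithin_apply]
  simp only [Set.preimage_univ, Set.univ_inter]
  rw [(hev u).lieBracketWithin_vectorField_eq_of_mem (hev v) (Set.mem_range_self _)]
  have h0 (a b : E) (S : Set E) :
      lieBracketWithin ℝ (fun _ ↦ a) (fun _ ↦ b) S (extChartAt I x x) = 0 := by
    simp [lieBracketWithin]
  exact (congrArg _ (h0 _ _ _)).trans (map_zero _)

variable [RiemannianBundle (fun x : M ↦ TangentSpace I x)]
  [IsContMDiffRiemannianBundle I ∞ E (fun x : M ↦ TangentSpace I x)]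

theorem leviCivita_extend_comm {x : M} (u v : TangentSpace I x) :
    leviCivita I M (extend E u) x v = leviCivita I M (extend E v) x u := by
  have h := (CovariantDerivative.torsion_eq_zero_iff _).1 (leviCivita_torsion (I := I) (M := M))
    (mdifferentiableAt_extend I E v) (mdifferentiableAt_extend I E u)
  rw [mlieBracket_extend, extend_apply_self, extend_apply_self] at h
  exact sub_eq_zero.1 h

variable {E' : Type*} [NormedAddCommGroup E'] [NormedSpace ℝ E'] [FiniteDimensional ℝ E']
  {H' : Type*} [TopologicalSpace H'] {I' : ModelWithCorners ℝ E' H'} [I'.Boundaryless]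
  {N : Type*} [TopologicalSpace N] [ChartedSpace H' N] [IsManifold I' ∞ N]

/-- `∇_{F_* v} (F_* u) = ∇_{F_* u} (F_* v)` for the fields `u`, `v` constant in the preferred chart
at `x`, since second derivatives in charts are symmetric and the Levi-Civita connection is torsion
free. -/
theorem derivAlong_extend_comm {F : N → M} (hF : ContMDiff I' I ∞ F) (x : N)
    (u v : TangentSpace I' x) :
    derivAlong I I' F (fun y ↦ mfderiv I' I F y (extend E' u y)) x v =
      derivAlong I I' F (fun y ↦ mfderiv I' I F y (extend E' v y)) x u := by
  set φ := extChartAt I (F x)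
  set ψ := extChartAt I' x
  set e := trivializationAt E (TangentSpace I : M → Type _) (F x)
  set e' := trivializationAt E' (TangentSpace I' : N → Type _) x
  -- In the preferred charts `F` reads as `G`. The coordinates of `F_* w`, for `w` constant in the
  -- chart, are `DG(w)`, with derivative `D²G(·, w)`.
  let G : E' → E := φ ∘ F ∘ ψ.symm
  have hG : ContDiffAt ℝ ∞ G (ψ x) := by
    have h := ((contMDiffAt_iff ..).1 (hF x)).2
    rwa [I'.range_eq_univ, contDiffWithinAt_univ] at h
  have hG2 : DifferentiableAt ℝ (fderiv ℝ G) (ψ x) :=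
    (hG.fderiv_right (m := 1) (by norm_num; exact ENat.LEInfty.out)).differentiableAt one_ne_zero
  have hsym : IsSymmSndFDerivAt ℝ G (ψ x) := hG.isSymmSndFDerivAt (by simp; exact ENat.LEInfty.out)
  have hψd : MDifferentiableAt I' 𝓘(ℝ, E') ψ x :=
    mdifferentiableAt_extChartAt (mem_chart_source H' x)
  have hcoord (w : TangentSpace I' x) : (fun y ↦ e.continuousLinearMapAt ℝ (F y)
      (mfderiv I' I F y (extend E' w y))) =ᶠ[nhds x] fun y ↦
        fderiv ℝ G (ψ y) (e'.continuousLinearMapAt ℝ x w) := by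
    have h1 : ∀ᶠ y in nhds x, F y ∈ (chartAt H (F x)).source :=
      hF.continuous.continuousAt.preimage_mem_nhds (chart_source_mem_nhds H (F x))
    filter_upwards [h1, chart_source_mem_nhds H' x] with y hFy hy
    have hp : ψ y ∈ ψ.target := ψ.map_source (by rwa [extChartAt_source])
    have hinv : ψ.symm (ψ y) = y := ψ.left_inv (by rwa [extChartAt_source])
    rw [extend_eq_symmL w (by simpa using hy), TangentBundle.symmL_trivializationAt hy,
      TangentBundle.continuousLinearMapAt_trivializationAt hFy]
    have hs : MDifferentiableAt 𝓘(ℝ, E') I' ψ.symm (ψ y) := by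
      have := mdifferentiableWithinAt_extChartAt_symm hp
      rwa [I'.range_eq_univ, mdifferentiableWithinAt_univ] at this
    have hFd : MDifferentiableAt I' I F (ψ.symm (ψ y)) := by
      rw [hinv]; exact (hF y).mdifferentiableAt (by simp)
    have hφd : MDifferentiableAt I 𝓘(ℝ, E) φ ((F ∘ ψ.symm) (ψ y)) := by
      rw [Function.comp_apply, hinv]; exact mdifferentiableAt_extChartAt hFy
    have hc := mfderiv_comp (ψ y) hφd (hFd.comp (ψ y) hs)
    have hc' := mfderiv_comp (ψ y) hFd hs
    rw [mfderiv_eq_fderiv] at hc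
    have hc2 := congrArg (fun L ↦ L (e'.continuousLinearMapAt ℝ x w)) hc
    rw [hc'] at hc2
    rw [I'.range_eq_univ, mfderivWithin_univ]
    have hpt (y' : N) (L : E') (h : y' = y) :
        (mfderiv I 𝓘(ℝ, E) φ (F y) (mfderiv I' I F y L) : E) =
          mfderiv I 𝓘(ℝ, E) φ (F y') (mfderiv I' I F y' L) := by
      subst h; rfl
    exact (hpt _ _ hinv).trans hc2.symm
  have hD (w w' : TangentSpace I' x) : mvfderiv I' (fun y ↦ e.continuousLinearMapAt ℝ (F y)
      (mfderiv I' I F y (extend E' w y))) x w' = fderiv ℝ (fderiv ℝ G) (ψ x)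
        (e'.continuousLinearMapAt ℝ x w') (e'.continuousLinearMapAt ℝ x w) := by
    rw [mvfderiv_congr (hcoord w)]
    have hd : DifferentiableAt ℝ (fun p ↦ fderiv ℝ G p (e'.continuousLinearMapAt ℝ x w)) (ψ x) :=
      hG2.clm_apply (differentiableAt_const _)
    have h := congrArg (fun L ↦ L w') (mfderiv_comp x hd.mdifferentiableAt hψd)
    rw [mfderiv_eq_fderiv, fderiv_clm_apply hG2 (differentiableAt_const _)] at h
    refine Eq.trans h ?_
    rw [TangentBundle.continuousLinearMapAt_trivializationAt (mem_chart_source H' x)]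
    simp
    rfl
  simp only [derivAlong, add_apply, ContinuousLinearMap.comp_apply, extend_apply_self]
  rw [leviCivita_extend_comm]
  congr 2
  exact (hD u v).trans ((hsym _ _).trans (hD v u).symm)

end Symmetry

/-! ### Fields constant in a product chart -/

section ChartFields

variable {E : Type*} [NormedAddCommGroup E] [NormedSpace ℝ E]
  {H : Type*} [TopologicalSpace H] {I : ModelWithCorners ℝ E H} [I.Boundaryless]
  {M : Type*} [TopologicalSpace M] [ChartedSpace H M] [IsManifold I ∞ M]

theorem mdifferentiableAt_extChartAt_symm {x : M} {p : E} (hp : p ∈ (extChartAt I x).target) :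
    MDifferentiableAt 𝓘(ℝ, E) I (extChartAt I x).symm p := by
  have := mdifferentiableWithinAt_extChartAt_symm hp
  rwa [I.range_eq_univ, mdifferentiableWithinAt_univ] at this

theorem extend_eq_mfderiv_extChartAt_symm [FiniteDimensional ℝ E] {x y : M} (v : TangentSpace I x)
    (hy : y ∈ (chartAt H x).source) :
    extend E v y = mfderiv 𝓘(ℝ, E) I (extChartAt I x).symm (extChartAt I x y) v := by
  rw [extend_eq_symmL v (by simpa using hy), TangentBundle.symmL_trivializationAt hy,
    I.range_eq_univ, mfderivWithin_univ,
    TangentBundle.continuousLinearMapAt_trivializationAt (mem_chart_source H x),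
    mfderiv_extChartAt_self]
  rfl

end ChartFields

section Product

variable {E₁ : Type*} [NormedAddCommGroup E₁] [NormedSpace ℝ E₁] [FiniteDimensional ℝ E₁]
  {H₁ : Type*} [TopologicalSpace H₁] {I₁ : ModelWithCorners ℝ E₁ H₁} [I₁.Boundaryless]
  {M₁ : Type*} [TopologicalSpace M₁] [ChartedSpace H₁ M₁] [IsManifold I₁ ∞ M₁]
  {E₂ : Type*} [NormedAddCommGroup E₂] [NormedSpace ℝ E₂] [FiniteDimensional ℝ E₂]
  {H₂ : Type*} [TopologicalSpace H₂] {I₂ : ModelWithCorners ℝ E₂ H₂} [I₂.Boundaryless]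
  {M₂ : Type*} [TopologicalSpace M₂] [ChartedSpace H₂ M₂] [IsManifold I₂ ∞ M₂]

theorem mfderiv_fst_extend {z z' : M₁ × M₂} (w : TangentSpace (I₁.prod I₂) z)
    (hz' : z' ∈ (chartAt (ModelProd H₁ H₂) z).source) :
    mfderiv (I₁.prod I₂) I₁ Prod.fst z' (extend (E₁ × E₂) w z') =
      extend E₁ (mfderiv (I₁.prod I₂) I₁ Prod.fst z w) z'.1 := by
  have hz₁ : z'.1 ∈ (chartAt H₁ z.1).source := by simp at hz'; exact hz'.1
  have hp : extChartAt (I₁.prod I₂) z z' ∈ (extChartAt (I₁.prod I₂) z).target :=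
    (extChartAt (I₁.prod I₂) z).map_source (by rwa [extChartAt_source])
  have hp₁ : extChartAt I₁ z.1 z'.1 ∈ (extChartAt I₁ z.1).target :=
    (extChartAt I₁ z.1).map_source (by rwa [extChartAt_source])
  rw [extend_eq_mfderiv_extChartAt_symm _ hz', extend_eq_mfderiv_extChartAt_symm _ hz₁,
    mfderiv_fst, mfderiv_fst]
  have h1 := mfderiv_comp (extChartAt (I₁.prod I₂) z z')
    (mdifferentiableAt_fst (I := I₁) (I' := I₂)
      (x := (extChartAt (I₁.prod I₂) z).symm (extChartAt (I₁.prod I₂) z z')))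
    (mdifferentiableAt_extChartAt_symm hp)
  have h2 := mfderiv_comp (extChartAt (I₁.prod I₂) z z')
    (f := (Prod.fst : E₁ × E₂ → E₁)) (I' := 𝓘(ℝ, E₁))
    (mdifferentiableAt_extChartAt_symm (I := I₁) hp₁)
    (differentiableAt_fst.mdifferentiableAt)
  have h3 : (Prod.fst : M₁ × M₂ → M₁) ∘ (extChartAt (I₁.prod I₂) z).symm =
    (extChartAt I₁ z.1).symm ∘ (Prod.fst : E₁ × E₂ → E₁) := rfl
  rw [h3] at h1
  have h4 := congrArg (fun L ↦ L w) (h1.symm.trans h2)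
  rw [mfderiv_fst, mfderiv_eq_fderiv, fderiv_fst] at h4
  exact h4

theorem mfderiv_snd_extend {z z' : M₁ × M₂} (w : TangentSpace (I₁.prod I₂) z)
    (hz' : z' ∈ (chartAt (ModelProd H₁ H₂) z).source) :
    mfderiv (I₁.prod I₂) I₂ Prod.snd z' (extend (E₁ × E₂) w z') =
      extend E₂ (mfderiv (I₁.prod I₂) I₂ Prod.snd z w) z'.2 := by
  have hz₂ : z'.2 ∈ (chartAt H₂ z.2).source := by simp at hz'; exact hz'.2
  have hp : extChartAt (I₁.prod I₂) z z' ∈ (extChartAt (I₁.prod I₂) z).target :=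
    (extChartAt (I₁.prod I₂) z).map_source (by rwa [extChartAt_source])
  have hp₂ : extChartAt I₂ z.2 z'.2 ∈ (extChartAt I₂ z.2).target :=
    (extChartAt I₂ z.2).map_source (by rwa [extChartAt_source])
  rw [extend_eq_mfderiv_extChartAt_symm _ hz', extend_eq_mfderiv_extChartAt_symm _ hz₂,
    mfderiv_snd, mfderiv_snd]
  have h1 := mfderiv_comp (extChartAt (I₁.prod I₂) z z')
    (mdifferentiableAt_snd (I := I₁) (I' := I₂)
      (x := (extChartAt (I₁.prod I₂) z).symm (extChartAt (I₁.prod I₂) z z')))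
    (mdifferentiableAt_extChartAt_symm hp)
  have h2 := mfderiv_comp (extChartAt (I₁.prod I₂) z z')
    (f := (Prod.snd : E₁ × E₂ → E₂)) (I' := 𝓘(ℝ, E₂))
    (mdifferentiableAt_extChartAt_symm (I := I₂) hp₂)
    (differentiableAt_snd.mdifferentiableAt)
  have h3 : (Prod.snd : M₁ × M₂ → M₂) ∘ (extChartAt (I₁.prod I₂) z).symm =
    (extChartAt I₂ z.2).symm ∘ (Prod.snd : E₁ × E₂ → E₂) := rfl
  rw [h3] at h1
  have h4 := congrArg (fun L ↦ L w) (h1.symm.trans h2)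
  rw [mfderiv_snd, mfderiv_eq_fderiv, fderiv_snd] at h4
  exact h4

variable (I₁ I₂) in
/-- The distribution on `M₁ × M₂` of the vectors tangent to `M₂`. -/
def fiberDistribution (z : M₁ × M₂) : Submodule ℝ (TangentSpace (I₁.prod I₂) z) :=
  LinearMap.ker (mfderiv (I₁.prod I₂) I₁ (Prod.fst : M₁ × M₂ → M₁) z).toLinearMap

theorem mem_baseDistribution_iff {z : M₁ × M₂} {w : TangentSpace (I₁.prod I₂) z} :
    w ∈ baseDistribution I₁ I₂ z ↔ mfderiv (I₁.prod I₂) I₂ Prod.snd z w = 0 := Iff.rfl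

theorem mem_fiberDistribution_iff {z : M₁ × M₂} {w : TangentSpace (I₁.prod I₂) z} :
    w ∈ fiberDistribution I₁ I₂ z ↔ mfderiv (I₁.prod I₂) I₁ Prod.fst z w = 0 := Iff.rfl

variable (I₁) in
/-- The vector tangent to `M₂` at `z` with component `b`. -/
def fiberVector (z : M₁ × M₂) (b : TangentSpace I₂ z.2) : TangentSpace (I₁.prod I₂) z :=
  ContinuousLinearMap.inr ℝ (TangentSpace I₁ z.1) (TangentSpace I₂ z.2) b

theorem fiberVector_mem (z : M₁ × M₂) (b : TangentSpace I₂ z.2) :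
    fiberVector I₁ z b ∈ fiberDistribution I₁ I₂ z := by
  rw [mem_fiberDistribution_iff, mfderiv_fst]
  rfl

theorem mfderiv_snd_fiberVector (z : M₁ × M₂) (b : TangentSpace I₂ z.2) :
    mfderiv (I₁.prod I₂) I₂ Prod.snd z (fiberVector I₁ z b) = b := by
  rw [mfderiv_snd]
  rfl

theorem fiberVector_mfderiv_snd {z : M₁ × M₂} {v : TangentSpace (I₁.prod I₂) z}
    (hv : v ∈ fiberDistribution I₁ I₂ z) :
    fiberVector I₁ z (mfderiv (I₁.prod I₂) I₂ Prod.snd z v) = v := by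
  rw [mem_fiberDistribution_iff, mfderiv_fst] at hv
  rw [mfderiv_snd]
  exact Prod.ext hv.symm rfl

theorem extend_zero {E : Type*} [NormedAddCommGroup E] [NormedSpace ℝ E] [FiniteDimensional ℝ E]
    {H : Type*} [TopologicalSpace H] {I : ModelWithCorners ℝ E H}
    {M : Type*} [TopologicalSpace M] [ChartedSpace H M] [IsManifold I ∞ M] {x y : M}
    (hy : y ∈ (chartAt H x).source) : extend E (0 : TangentSpace I x) y = 0 := by
  rw [extend_eq_symmL _ (by simpa using hy), map_zero, map_zero]

theorem extend_mem_baseDistribution {z z' : M₁ × M₂} {w : TangentSpace (I₁.prod I₂) z}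
    (hw : w ∈ baseDistribution I₁ I₂ z) (hz' : z' ∈ (chartAt (ModelProd H₁ H₂) z).source) :
    extend (E₁ × E₂) w z' ∈ baseDistribution I₁ I₂ z' := by
  rw [mem_baseDistribution_iff] at *
  rw [mfderiv_snd_extend w hz', hw]
  exact extend_zero (by simp at hz'; exact hz'.2)

theorem extend_mem_fiberDistribution {z z' : M₁ × M₂} {w : TangentSpace (I₁.prod I₂) z}
    (hw : w ∈ fiberDistribution I₁ I₂ z) (hz' : z' ∈ (chartAt (ModelProd H₁ H₂) z).source) :
    extend (E₁ × E₂) w z' ∈ fiberDistribution I₁ I₂ z' := by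
  rw [mem_fiberDistribution_iff] at *
  rw [mfderiv_fst_extend w hz', hw]
  exact extend_zero (by simp at hz'; exact hz'.1)

end Product

/-! ### Warped product semi-slant immersions -/

section SemiSlant

variable {E₁ : Type*} [NormedAddCommGroup E₁] [NormedSpace ℝ E₁] [FiniteDimensional ℝ E₁]
  {H₁ : Type*} [TopologicalSpace H₁] {I₁ : ModelWithCorners ℝ E₁ H₁} [I₁.Boundaryless]
  {M₁ : Type*} [TopologicalSpace M₁] [ChartedSpace H₁ M₁] [IsManifold I₁ ∞ M₁]
  [RiemannianBundle (fun x : M₁ ↦ TangentSpace I₁ x)]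
  [IsContMDiffRiemannianBundle I₁ ∞ E₁ (fun x : M₁ ↦ TangentSpace I₁ x)]
  {E₂ : Type*} [NormedAddCommGroup E₂] [NormedSpace ℝ E₂] [FiniteDimensional ℝ E₂]
  {H₂ : Type*} [TopologicalSpace H₂] {I₂ : ModelWithCorners ℝ E₂ H₂} [I₂.Boundaryless]
  {M₂ : Type*} [TopologicalSpace M₂] [ChartedSpace H₂ M₂] [IsManifold I₂ ∞ M₂]
  [RiemannianBundle (fun y : M₂ ↦ TangentSpace I₂ y)]
  {E : Type*} [NormedAddCommGroup E] [NormedSpace ℝ E] [FiniteDimensional ℝ E]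
  {H : Type*} [TopologicalSpace H] {I : ModelWithCorners ℝ E H}
  {M : Type*} [TopologicalSpace M] [ChartedSpace H M] [IsManifold I ∞ M]
  [RiemannianBundle (fun x : M ↦ TangentSpace I x)]
  [IsContMDiffRiemannianBundle I ∞ E (fun x : M ↦ TangentSpace I x)]

theorem warpedMetric_eq_zero {f : M₁ → ℝ} {z : M₁ × M₂} {v w : TangentSpace (I₁.prod I₂) z}
    (hv : v ∈ fiberDistribution I₁ I₂ z) (hw : w ∈ baseDistribution I₁ I₂ z) :
    warpedMetric I₁ I₂ f z v w = 0 := by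
  rw [mem_baseDistribution_iff] at hw
  rw [mem_fiberDistribution_iff] at hv
  rw [warpedMetric, hv, hw, inner_zero_left, inner_zero_right, mul_zero, add_zero]

/-- A vector orthogonal to the fibres of a warped product is tangent to the base. -/
theorem mem_baseDistribution_of_warpedMetric {f : M₁ → ℝ} {z : M₁ × M₂} (hf : 0 < f z.1)
    {a : TangentSpace (I₁.prod I₂) z}
    (h : ∀ v ∈ fiberDistribution I₁ I₂ z, warpedMetric I₁ I₂ f z a v = 0) :
    a ∈ baseDistribution I₁ I₂ z := by
  have h0 := h _ (fiberVector_mem z (mfderiv (I₁.prod I₂) I₂ Prod.snd z a))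
  rw [warpedMetric, mem_fiberDistribution_iff.1 (fiberVector_mem _ _), mfderiv_snd_fiberVector,
    inner_zero_right, zero_add] at h0
  exact inner_self_eq_zero.1 ((mul_eq_zero.1 h0).resolve_left (pow_ne_zero 2 hf.ne'))

variable {J : Π y : M, TangentSpace I y →L[ℝ] TangentSpace I y} {f : M₁ → ℝ} {F : M₁ × M₂ → M}
  {θ : M₁ × M₂ → ℝ}

/-- If `F` is isometric for a warped product metric, then the base leaves are totally geodesic
in the warped product: `∇_{F_* u} (F_* W)` has no component tangent to the fibres, for `u` and `W`
tangent to the base. -/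
theorem inner_derivAlong_extend_eq_zero (hF : ContMDiff (I₁.prod I₂) I ∞ F)
    (hiso : ∀ (z : M₁ × M₂) (v w : TangentSpace (I₁.prod I₂) z),
      inner ℝ (mfderiv (I₁.prod I₂) I F z v) (mfderiv (I₁.prod I₂) I F z w) =
        warpedMetric I₁ I₂ f z v w) {z : M₁ × M₂} {u w v : TangentSpace (I₁.prod I₂) z}
    (hu : u ∈ baseDistribution I₁ I₂ z) (hw : w ∈ baseDistribution I₁ I₂ z)
    (hv : v ∈ fiberDistribution I₁ I₂ z) :
    inner ℝ (mfderiv (I₁.prod I₂) I F z v) (derivAlong I (I₁.prod I₂) F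
      (fun y ↦ mfderiv (I₁.prod I₂) I F y (extend (E₁ × E₂) w y)) z u) = 0 := by
  have hFz : MDifferentiableAt (I₁.prod I₂) I F z := (hF z).mdifferentiableAt (by simp)
  let s (a : TangentSpace (I₁.prod I₂) z) (y : M₁ × M₂) : TangentSpace I (F y) :=
    mfderiv (I₁.prod I₂) I F y (extend (E₁ × E₂) a y)
  have hs a : MDiffAlongAt I (I₁.prod I₂) F (s a) z :=
    mdifferentiableAt_push hF (mdifferentiableAt_extend (I₁.prod I₂) (E₁ × E₂) a)
  have hsz a : s a z = mfderiv (I₁.prod I₂) I F z a := by simp only [s, extend_apply_self]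
  have hsrc := chart_source_mem_nhds (ModelProd H₁ H₂) z
  have hcomm (a b) : derivAlong I (I₁.prod I₂) F (s a) z b =
      derivAlong I (I₁.prod I₂) F (s b) z a := derivAlong_extend_comm hF z a b
  have hmix {a} (ha : a ∈ baseDistribution I₁ I₂ z) (b) :
      mvfderiv (I₁.prod I₂) (fun y ↦ inner ℝ (s v y) (s a y)) z b = 0 := by
    have h0 : (fun y ↦ inner ℝ (s v y) (s a y)) =ᶠ[nhds z] fun _ ↦ (0 : ℝ) := by
      filter_upwards [hsrc] with y hy
      rw [hiso]
      exact warpedMetric_eq_zero (extend_mem_fiberDistribution hv hy)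
        (extend_mem_baseDistribution ha hy)
    rw [mvfderiv_congr h0, mvfderiv_const]
    rfl
  -- The metric of the base does not depend on the point of the fibre.
  have hbase : mvfderiv (I₁.prod I₂) (fun y ↦ inner ℝ (s u y) (s w y)) z v = 0 := by
    let k (y : M₁) : ℝ := inner ℝ (extend E₁ (mfderiv (I₁.prod I₂) I₁ Prod.fst z u) y)
      (extend E₁ (mfderiv (I₁.prod I₂) I₁ Prod.fst z w) y)
    have hk : MDifferentiableAt I₁ 𝓘(ℝ, ℝ) k z.1 :=
      mdifferentiableAt_inner (mdifferentiableAt_extend I₁ E₁ _)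
        (mdifferentiableAt_extend I₁ E₁ _)
    have h0 : (fun y ↦ inner ℝ (s u y) (s w y)) =ᶠ[nhds z] k ∘ Prod.fst := by
      filter_upwards [hsrc] with y hy
      have hy₂ := mem_baseDistribution_iff.1 (extend_mem_baseDistribution hw hy)
      rw [hiso, warpedMetric, hy₂, inner_zero_right, mul_zero, add_zero, mfderiv_fst_extend _ hy,
        mfderiv_fst_extend _ hy]
      rfl
    rw [mvfderiv_congr h0, mvfderiv_comp_apply z hk mdifferentiableAt_fst,
      mem_fiberDistribution_iff.1 hv, map_zero]
  have h1 := (mvfderiv_inner_along hFz (hs v) (hs w)).2 u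
  have h2 := (mvfderiv_inner_along hFz (hs v) (hs u)).2 w
  have h3 := (mvfderiv_inner_along hFz (hs u) (hs w)).2 v
  rw [hmix hw] at h1
  rw [hmix hu] at h2
  rw [hcomm u w] at h2
  rw [hbase, hcomm u v, hcomm w v, real_inner_comm _ (s u z)] at h3
  rw [← hsz]
  change inner ℝ (s v z) (derivAlong I (I₁.prod I₂) F (s w) z u) = 0
  linarith

/-- `J` maps the vectors tangent to the invariant leaves to vectors tangent to these leaves. -/
theorem IsWarpedProductSemiSlant.exists_apply_mfderiv
    (hF : IsWarpedProductSemiSlant I₁ I₂ I J f F θ) {z : M₁ × M₂}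
    {v : TangentSpace (I₁.prod I₂) z} (hv : v ∈ fiberDistribution I₁ I₂ z) :
    ∃ v' ∈ fiberDistribution I₁ I₂ z, J (F z) (mfderiv (I₁.prod I₂) I F z v) =
      mfderiv (I₁.prod I₂) I F z v' := by
  have hleaf (b : TangentSpace I₂ z.2) : mfderiv I₂ I (fun y ↦ F (z.1, y)) z.2 b =
      mfderiv (I₁.prod I₂) I F z (fiberVector I₁ z b) := by
    have h := mfderiv_comp z.2 (g := F) (f := fun y : M₂ ↦ (z.1, y)) (I' := I₁.prod I₂)
      ((hF.smooth _).mdifferentiableAt (by simp))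
      (mdifferentiableAt_const.prodMk mdifferentiableAt_id)
    rw [mfderiv_prod_right] at h
    exact congrArg (fun L ↦ L b) h
  obtain ⟨b, hb⟩ := hF.invariant z.1 z.2 (mfderiv (I₁.prod I₂) I₂ Prod.snd z v)
  rw [hleaf, fiberVector_mfderiv_snd hv] at hb
  exact ⟨fiberVector I₁ z b, fiberVector_mem z b, hb.symm.trans (hleaf b)⟩

/-- The second fundamental form `h(u, v)`, for `u` tangent to the slant leaves and `v` tangent to
the invariant leaves, is orthogonal to `N w` for all `w` tangent to the slant leaves. -/
theorem IsWarpedProductSemiSlant.inner_secondFundamentalForm_normalPart {p q : ℕ}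
    (hJ : IsLocallyMetallic p q J)
    (hF : IsWarpedProductSemiSlant I₁ I₂ I J f F θ) {z : M₁ × M₂}
    {u w v : TangentSpace (I₁.prod I₂) z}
    (hu : u ∈ baseDistribution I₁ I₂ z) (hw : w ∈ baseDistribution I₁ I₂ z)
    (hv : v ∈ fiberDistribution I₁ I₂ z) :
    inner ℝ (secondFundamentalForm I (I₁.prod I₂) F z u v)
      (normalPart I (I₁.prod I₂) J F z (mfderiv (I₁.prod I₂) I F z w)) = 0 := by
  have hFz : MDifferentiableAt (I₁.prod I₂) I F z := (hF.smooth z).mdifferentiableAt (by simp)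
  let s (a : TangentSpace (I₁.prod I₂) z) (y : M₁ × M₂) : TangentSpace I (F y) :=
    mfderiv (I₁.prod I₂) I F y (extend (E₁ × E₂) a y)
  have hs a : MDiffAlongAt I (I₁.prod I₂) F (s a) z :=
    mdifferentiableAt_push hF.smooth (mdifferentiableAt_extend (I₁.prod I₂) (E₁ × E₂) a)
  have hsz a : s a z = mfderiv (I₁.prod I₂) I F z a := by simp only [s, extend_apply_self]
  have hsrc := chart_source_mem_nhds (ModelProd H₁ H₂) z
  have hgeo {a b} (ha : a ∈ baseDistribution I₁ I₂ z) (hb : b ∈ fiberDistribution I₁ I₂ z) :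
      inner ℝ (mfderiv (I₁.prod I₂) I F z b) (derivAlong I (I₁.prod I₂) F (s a) z u) = 0 :=
    inner_derivAlong_extend_eq_zero hF.smooth hF.isometric hu ha hb
  -- A field along `F` tangent to the fibres has derivative along `u` orthogonal to the base.
  have horth (t : Π y : M₁ × M₂, TangentSpace I (F y))
      (ht : MDiffAlongAt I (I₁.prod I₂) F t z)
      (htv : ∀ᶠ y in nhds z, ∃ b ∈ fiberDistribution I₁ I₂ y,
        t y = mfderiv (I₁.prod I₂) I F y b) {a} (ha : a ∈ baseDistribution I₁ I₂ z) :
      inner ℝ (derivAlong I (I₁.prod I₂) F t z u) (mfderiv (I₁.prod I₂) I F z a) = 0 := by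
    have h0 : (fun y ↦ inner ℝ (t y) (s a y)) =ᶠ[nhds z] fun _ ↦ (0 : ℝ) := by
      filter_upwards [htv, hsrc] with y ⟨b, hb, hty⟩ hy
      rw [hty, hF.isometric]
      exact warpedMetric_eq_zero hb (extend_mem_baseDistribution ha hy)
    have h1 := (mvfderiv_inner_along hFz ht (hs a)).2 u
    obtain ⟨b, hb, htz⟩ := htv.self_of_nhds
    rw [mvfderiv_congr h0, mvfderiv_const, htz, hgeo ha hb, add_zero, hsz] at h1
    exact h1.symm
  set D := derivAlong I (I₁.prod I₂) F (s v) z u with hD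
  have hsv : ∀ᶠ y in nhds z, ∃ b ∈ fiberDistribution I₁ I₂ y,
      s v y = mfderiv (I₁.prod I₂) I F y b := by
    filter_upwards [hsrc] with y hy
    exact ⟨_, extend_mem_fiberDistribution hv hy, rfl⟩
  obtain ⟨hJs, hJd⟩ := hJ.derivAlong_apply hFz (hs v)
  have h1 : inner ℝ D (J (F z) (mfderiv (I₁.prod I₂) I F z w)) = 0 := by
    rw [← hJ.symm, hD, ← hJd]
    refine horth _ hJs (hsv.mono fun y hy ↦ ?_) hw
    obtain ⟨b, hb, hy⟩ := hy
    rw [hy]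
    exact hF.exists_apply_mfderiv hb
  -- The tangential part of `J w` is tangent to the slant leaves, as `J` is symmetric and preserves
  -- the tangent spaces of the invariant leaves.
  obtain ⟨w', hw'⟩ : (tangentRange I (I₁.prod I₂) F z).starProjection
      (J (F z) (mfderiv (I₁.prod I₂) I F z w)) ∈ tangentRange I (I₁.prod I₂) F z :=
    Submodule.starProjection_apply_mem _ _
  replace hw' : mfderiv (I₁.prod I₂) I F z w' = _ := hw'
  have hw'base : w' ∈ baseDistribution I₁ I₂ z := by
    refine mem_baseDistribution_of_warpedMetric (f := f) (hF.warping_pos _) fun b hb ↦ ?_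
    obtain ⟨b', hb', hJb⟩ := hF.exists_apply_mfderiv hb
    have hmem : mfderiv (I₁.prod I₂) I F z b ∈ tangentRange I (I₁.prod I₂) F z := ⟨b, rfl⟩
    rw [← hF.isometric, hw', Submodule.inner_starProjection_left_eq_right,
      Submodule.starProjection_eq_self_iff.2 hmem]
    refine (hJ.symm _ _ _).trans ?_
    rw [hJb, real_inner_comm, hF.isometric]
    exact warpedMetric_eq_zero hb' hw
  rw [secondFundamentalForm, normalPart, Submodule.inner_starProjection_left_eq_right,
    Submodule.starProjection_eq_self_iff.2 (Submodule.starProjection_apply_mem _ _),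
    Submodule.starProjection_orthogonal_val, ← hw', inner_sub_right]
  exact sub_eq_zero.2 (h1.trans (horth _ (hs v) hsv hw'base).symm)

theorem IsWarpedProductSemiSlant.mfderiv_injective
    (hF : IsWarpedProductSemiSlant I₁ I₂ I J f F θ) (z : M₁ × M₂) :
    Function.Injective (mfderiv (I₁.prod I₂) I F z) := by
  rw [injective_iff_map_eq_zero]
  intro a ha
  have h0 (b : TangentSpace (I₁.prod I₂) z) : warpedMetric I₁ I₂ f z a b = 0 := by
    rw [← hF.isometric, ha, inner_zero_left]
  have h₂ : mfderiv (I₁.prod I₂) I₂ Prod.snd z a = 0 :=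
    mem_baseDistribution_of_warpedMetric (hF.warping_pos _) fun v _ ↦ h0 v
  have h₁ : mfderiv (I₁.prod I₂) I₁ Prod.fst z a = 0 := by
    have h := h0 a
    rw [warpedMetric, h₂, inner_zero_right, mul_zero, add_zero] at h
    exact inner_self_eq_zero.1 h
  rw [mfderiv_fst] at h₁
  rw [mfderiv_snd] at h₂
  exact Prod.ext h₁ h₂

/-- For `u` tangent to the slant leaves and every `ξ`, `A_{N T₁ ξ} u` is tangent to these leaves. -/
theorem IsWarpedProductSemiSlant.shapeOperator_mem_baseDistribution {p q : ℕ}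
    (hJ : IsLocallyMetallic p q J)
    (hF : IsWarpedProductSemiSlant I₁ I₂ I J f F θ) {z : M₁ × M₂}
    {u : TangentSpace (I₁.prod I₂) z} (hu : u ∈ baseDistribution I₁ I₂ z)
    (ξ : TangentSpace I (F z)) :
    shapeOperator I (I₁.prod I₂) F z (normalPart I (I₁.prod I₂) J F z
      (baseTangentialPart I₁ I₂ I J F z ξ)) u ∈ baseDistribution I₁ I₂ z := by
  obtain ⟨w, hw, hwξ⟩ := Submodule.starProjection_apply_mem
    ((baseDistribution I₁ I₂ z).map (mfderiv (I₁.prod I₂) I F z).toLinearMap)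
    (tangentialPart I (I₁.prod I₂) J F z ξ)
  replace hwξ : mfderiv (I₁.prod I₂) I F z w = baseTangentialPart I₁ I₂ I J F z ξ := hwξ
  refine mem_baseDistribution_of_warpedMetric (hF.warping_pos _) fun v hv ↦ ?_
  rw [← hF.isometric, shapeOperator_spec hF.smooth z (hF.mfderiv_injective z), ← hwξ]
  exact hF.inner_secondFundamentalForm_normalPart hJ hu hw hv

end SemiSlant

end

theorem mainTheorem2
    {E : Type*} [NormedAddCommGroup E] [NormedSpace ℝ E] [FiniteDimensional ℝ E]
    {M : Type*} [TopologicalSpace M] [ChartedSpace E M] [IsManifold 𝓘(ℝ, E) ∞ M]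
    [RiemannianBundle (fun x : M ↦ TangentSpace 𝓘(ℝ, E) x)]
    [IsContMDiffRiemannianBundle 𝓘(ℝ, E) ∞ E (fun x : M ↦ TangentSpace 𝓘(ℝ, E) x)]
    {E₁ : Type*} [NormedAddCommGroup E₁] [NormedSpace ℝ E₁] [FiniteDimensional ℝ E₁]
    {M₁ : Type*} [TopologicalSpace M₁] [ChartedSpace E₁ M₁] [IsManifold 𝓘(ℝ, E₁) ∞ M₁]
    [RiemannianBundle (fun x : M₁ ↦ TangentSpace 𝓘(ℝ, E₁) x)]
    [IsContMDiffRiemannianBundle 𝓘(ℝ, E₁) ∞ E₁ (fun x : M₁ ↦ TangentSpace 𝓘(ℝ, E₁) x)]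
    {E₂ : Type*} [NormedAddCommGroup E₂] [NormedSpace ℝ E₂] [FiniteDimensional ℝ E₂]
    {M₂ : Type*} [TopologicalSpace M₂] [ChartedSpace E₂ M₂] [IsManifold 𝓘(ℝ, E₂) ∞ M₂]
    [RiemannianBundle (fun y : M₂ ↦ TangentSpace 𝓘(ℝ, E₂) y)]
    [IsContMDiffRiemannianBundle 𝓘(ℝ, E₂) ∞ E₂ (fun y : M₂ ↦ TangentSpace 𝓘(ℝ, E₂) y)]
    (p q : ℕ) (J : Π y : M, TangentSpace 𝓘(ℝ, E) y →L[ℝ] TangentSpace 𝓘(ℝ, E) y)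
    (hJ : IsLocallyMetallic p q J)
    (f : M₁ → ℝ) (F : M₁ × M₂ → M) (θ : M₁ × M₂ → ℝ)
    (hF : IsWarpedProductSemiSlant 𝓘(ℝ, E₁) 𝓘(ℝ, E₂) 𝓘(ℝ, E) J f F θ)
    (hθ : ∀ z, θ z ∈ Set.Ioo 0 (Real.pi / 2))
    (X Y : Π z : M₁ × M₂, TangentSpace (𝓘(ℝ, E₁).prod 𝓘(ℝ, E₂)) z)
    (hX : ContMDiff (𝓘(ℝ, E₁).prod 𝓘(ℝ, E₂)) (𝓘(ℝ, E₁).prod 𝓘(ℝ, E₂)).tangent ∞ (T% X))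
    (hY : ContMDiff (𝓘(ℝ, E₁).prod 𝓘(ℝ, E₂)) (𝓘(ℝ, E₁).prod 𝓘(ℝ, E₂)).tangent ∞ (T% Y))
    (hX₁ : ∀ z, X z ∈ baseDistribution 𝓘(ℝ, E₁) 𝓘(ℝ, E₂) z)
    (hY₁ : ∀ z, Y z ∈ baseDistribution 𝓘(ℝ, E₁) 𝓘(ℝ, E₂) z) (z : M₁ × M₂) :
    let dF := mfderiv (𝓘(ℝ, E₁).prod 𝓘(ℝ, E₂)) 𝓘(ℝ, E) F z
    let T₁ := baseTangentialPart 𝓘(ℝ, E₁) 𝓘(ℝ, E₂) 𝓘(ℝ, E) J F z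
    let N := normalPart 𝓘(ℝ, E) (𝓘(ℝ, E₁).prod 𝓘(ℝ, E₂)) J F z
    let A := shapeOperator 𝓘(ℝ, E) (𝓘(ℝ, E₁).prod 𝓘(ℝ, E₂)) F z
    A (N (T₁ (dF (Y z)))) (X z) - A (N (T₁ (dF (X z)))) (Y z) ∈
      baseDistribution 𝓘(ℝ, E₁) 𝓘(ℝ, E₂) z := by
  intro dF T₁ N A
  exact Submodule.sub_mem _ (hF.shapeOperator_mem_baseDistribution hJ (hX₁ z) _)
    (hF.shapeOperator_mem_baseDistribution hJ (hY₁ z) _)
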